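/- Let $n\ge 2$, let $\mathbb S^n\subset\mathbb R^{n+1}$ be the unit sphere, and give $\mathbb S^n\times\mathbb R$ the product metric. For a smooth hypersurface $\Sigma$ of $\mathbb S^n\times\mathbb R$ with unit normal field $N$, the principal curvatures $k_1,\dots,k_n$ are the eigenvalues of the shape operator $AX=-\overline\nabla_X N$, and the (non-normalized) $r$-th mean curvature is $\sum_{i_1<\dots<i_r}k_{i_1}\cdots k_{i_r}$. The hypersurface $\Sigma$ is \emph{convex} if, at each of its points, all nonzero principal curvatures have the same sign, and \emph{strictly convex} if, in addition, no principal curvature vanishes at any point. It is \emph{rotational} if there is a point $o\in\mathbb S^n$ such that, for each $t\in\mathbb R$ for which $\Sigma$ is transversal to $\mathbb S^n\times\{t\}$, every connected component of $\Sigma\cap(\mathbb S^n\times\{t\})$ is contained in a geodesic sphere of $\mathbb S^n\times\{t\}$ centered at $(o,t)$. Set $S(n)=\int_0^{\pi/2}\sin^{n-1}(s)\,ds$. Theorem. For every $r\in\{1,\dots,n\}$ and every constant $H_r>0$ there is a smoothly embedded rotational hypersurface $\Sigma$ of $\mathbb S^n\times\mathbb R$, diffeomorphic to $\mathbb S^n$,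 with a smooth unit normal field with respect to which its $r$-th mean curvature is constant and equal to $H_r$, which is symmetric with respect to some horizontal hyperplane $\mathbb S^n\times\{t_0\}$ and such that: (i) $\Sigma$ is strictly convex if $r>1$, or if $r=1$ and $H_1>1/S(n)$; (ii) $\Sigma$ is convex but not strictly convex if $r=1$ and $H_1=1/S(n)$; (iii) $\Sigma$ is not convex if $r=1$ and $0<H_1<1/S(n)$. -/

import Mathlib

open scoped Manifold ContDiff Topology InnerProductSpace

noncomputable section

namespace SphereTimesLine

/-- The unit sphere `𝕊ⁿ` of `ℝⁿ⁺¹`. -/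
abbrev Sph (n : ℕ) : Type := Metric.sphere (0 : EuclideanSpace ℝ (Fin (n + 1))) 1

/-- The Euclidean space `ℝⁿ⁺¹ × ℝ` (with its Euclidean inner product), in which `𝕊ⁿ × ℝ` lies. The
product metric of `𝕊ⁿ × ℝ` is the one induced by this inner product. -/
abbrev Amb (n : ℕ) : Type := WithLp 2 (EuclideanSpace ℝ (Fin (n + 1)) × ℝ)

/-- The inclusion of `𝕊ⁿ × ℝ` in `ℝⁿ⁺¹ × ℝ`. -/
def incl {n : ℕ} (z : Sph n × ℝ) : Amb n := WithLp.toLp 2 ((z.1 : EuclideanSpace ℝ (Fin (n + 1))), z.2)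

/-- The unit normal at `z = (x, t)` of `𝕊ⁿ × ℝ` in `ℝⁿ⁺¹ × ℝ`, that is, `(x, 0)`. -/
def outer {n : ℕ} (z : Sph n × ℝ) : Amb n := WithLp.toLp 2 ((z.1 : EuclideanSpace ℝ (Fin (n + 1))), 0)

/-- The tangent space of `𝕊ⁿ × ℝ` at `z`, as a subspace of `ℝⁿ⁺¹ × ℝ`. -/
def ambTangent {n : ℕ} (z : Sph n × ℝ) : Submodule ℝ (Amb n) := (ℝ ∙ outer z)ᗮ

section Hypersurface

variable {n : ℕ} {M : Type*} [TopologicalSpace M] [ChartedSpace (EuclideanSpace ℝ (Fin n)) M]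

/-- `F` is a smooth embedding of the `n`-manifold `M` in `𝕊ⁿ × ℝ`, so that its image is an embedded
hypersurface: a smooth immersion which is a homeomorphism onto its image. -/
structure IsEmbeddedHypersurface (F : M → Sph n × ℝ) : Prop where
  smooth : ContMDiff (𝓡 n) ((𝓡 n).prod 𝓘(ℝ, ℝ)) ∞ F
  immersion : ∀ p : M, Function.Injective (mfderiv (𝓡 n) ((𝓡 n).prod 𝓘(ℝ, ℝ)) F p)
  isEmbedding : Topology.IsEmbedding F

/-- The differential of `F` at `p`, with the tangent vectors of `𝕊ⁿ × ℝ` seen as vectors of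
`ℝⁿ⁺¹ × ℝ`. -/
def diff (F : M → Sph n × ℝ) (p : M) : TangentSpace (𝓡 n) p →L[ℝ] Amb n :=
  mvfderiv (𝓡 n) (fun q => incl (F q)) p

/-- `N` is a smooth unit normal field of the hypersurface `F`: it is tangent to `𝕊ⁿ × ℝ`,
orthogonal to the hypersurface, and of norm one. -/
structure IsUnitNormal (F : M → Sph n × ℝ) (N : M → Amb n) : Prop where
  smooth : ContMDiff (𝓡 n) 𝓘(ℝ, Amb n) ∞ N
  mem_ambTangent : ∀ p : M, N p ∈ ambTangent (F p)
  orthogonal : ∀ (p : M) (X : TangentSpace (𝓡 n) p), ⟪N p, diff F p X⟫_ℝ = 0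
  norm_eq_one : ∀ p : M, ‖N p‖ = 1

/-- The covariant derivative `X ↦ ∇̄_X N` at `p` of a vector field `N` of `𝕊ⁿ × ℝ` along `F`, for the
Levi-Civita connection `∇̄` of `𝕊ⁿ × ℝ`: the orthogonal projection to the tangent space of `𝕊ⁿ × ℝ`
of the derivative of `N` in `ℝⁿ⁺¹ × ℝ`. -/
def covDeriv (F : M → Sph n × ℝ) (N : M → Amb n) (p : M) : TangentSpace (𝓡 n) p →L[ℝ] Amb n :=
  (ambTangent (F p)).starProjection ∘L mvfderiv (𝓡 n) N p

/-- The shape operator `A` of the hypersurface `F` with respect to `N` at `p`, read on the tangent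
space of `M`: for an immersion `F` with unit normal field `N`, the vector `∇̄_X N` is tangent to the
hypersurface, and `A X` is the unique vector whose image under the differential of `F`
is `-∇̄_X N`. -/
def shapeOperator (F : M → Sph n × ℝ) (N : M → Amb n) (p : M) :
    Module.End ℝ (EuclideanSpace ℝ (Fin n)) :=
  -((diff F p : EuclideanSpace ℝ (Fin n) →L[ℝ] Amb n).toLinearMap.leftInverse ∘ₗ
    (covDeriv F N p : EuclideanSpace ℝ (Fin n) →L[ℝ] Amb n).toLinearMap)

/-- The principal curvatures at `p`: the eigenvalues of the shape operator, with multiplicity. -/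
def principalCurvatures (F : M → Sph n × ℝ) (N : M → Amb n) (p : M) : Multiset ℝ :=
  (shapeOperator F N p).charpoly.roots

/-- The (non-normalized) `r`-th mean curvature at `p`: the `r`-th elementary symmetric function of
the principal curvatures. -/
def meanCurvature (F : M → Sph n × ℝ) (N : M → Amb n) (r : ℕ) (p : M) : ℝ :=
  (principalCurvatures F N p).esymm r

/-- The hypersurface is convex at `p`: all the nonzero principal curvatures have the same sign. -/
def IsConvexAt (F : M → Sph n × ℝ) (N : M → Amb n) (p : M) : Prop :=
  ∀ k ∈ principalCurvatures F N p, ∀ l ∈ principalCurvatures F N p,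
    k ≠ 0 → l ≠ 0 → SignType.sign k = SignType.sign l

/-- The hypersurface is strictly convex at `p`: it is convex at `p`, and no principal curvature
vanishes there. -/
def IsStrictlyConvexAt (F : M → Sph n × ℝ) (N : M → Amb n) (p : M) : Prop :=
  IsConvexAt F N p ∧ ∀ k ∈ principalCurvatures F N p, k ≠ 0

/-- The hypersurface is convex: it is so at all of its points. -/
def IsConvex (F : M → Sph n × ℝ) (N : M → Amb n) : Prop := ∀ p : M, IsConvexAt F N p

/-- The hypersurface is strictly convex: it is so at all of its points. -/
def IsStrictlyConvex (F : M → Sph n × ℝ) (N : M → Amb n) : Prop := ∀ p : M, IsStrictlyConvexAt F N p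

/-- The hypersurface meets the horizontal hyperplane `𝕊ⁿ × {t}` transversally: at each common point,
some tangent vector of the hypersurface has a nonzero vertical component. -/
def IsTransversal (F : M → Sph n × ℝ) (t : ℝ) : Prop :=
  ∀ p : M, (F p).2 = t → ∃ X : TangentSpace (𝓡 n) p, (diff F p X).snd ≠ 0

/-- The intersection of the hypersurface with the horizontal hyperplane `𝕊ⁿ × {t}`. -/
def horizontalSection (F : M → Sph n × ℝ) (t : ℝ) : Set (Sph n × ℝ) :=
  {z | z ∈ Set.range F ∧ z.2 = t}

/-- The geodesic sphere of `𝕊ⁿ × {t}` with center `(o, t)` and radius `s`; the geodesic distance of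
two points of the unit sphere is the angle between them. -/
def geodesicSphere (o : Sph n) (s t : ℝ) : Set (Sph n × ℝ) :=
  {z | InnerProductGeometry.angle (o : EuclideanSpace ℝ (Fin (n + 1))) z.1 = s ∧ z.2 = t}

/-- The hypersurface is rotational about the axis `{o} × ℝ`, for some `o`: each connected component of
each (transversal) horizontal section lies in a geodesic sphere centered at the axis. -/
def IsRotational (F : M → Sph n × ℝ) : Prop :=
  ∃ o : Sph n, ∀ t : ℝ, IsTransversal F t → ∀ z ∈ horizontalSection F t,
    ∃ s ∈ Set.Ioo 0 Real.pi, connectedComponentIn (horizontalSection F t) z ⊆ geodesicSphere o s t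

/-- The image of `F` is symmetric with respect to the horizontal hyperplane `𝕊ⁿ × {t₀}`. -/
def IsSymmetricAbout (F : M → Sph n × ℝ) (t₀ : ℝ) : Prop :=
  ∀ (x : Sph n) (t : ℝ), (x, t) ∈ Set.range F ↔ (x, 2 * t₀ - t) ∈ Set.range F

end Hypersurface

/-- The constant `S(n) = ∫₀^{π/2} sinⁿ⁻¹(s) ds` (for `n ≥ 1`). -/
def sineIntegral (n : ℕ) : ℝ := ∫ s in (0 : ℝ)..(Real.pi / 2), Real.sin s ^ (n - 1)

end SphereTimesLine

end

/-!
The hypersurface is parametrized by its Gauss map. Fix an axis `e ∈ 𝕊ⁿ`. At a point of a rotational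
sphere whose unit normal makes the angle `θ` with the vertical direction, and which lies at the
distance `s` from the axis, the principal curvatures are `cos s sin θ / sin s`, with multiplicity
`n - 1`, and `d(sin θ)/ds`. When the latter is positive, `s` and the height are functions of `θ`,
and the sphere is the image of `p ↦ (a(w) (p - x e) + b(w) e, T(x))`, where `x = ⟪e, p⟫ = cos θ` and
`w = 1 - x² = sin² θ`, with `a = sin s / sin θ`, `b = cos s` and `T' = 2 b' / a`; the unit normal is
`(-b (p - x e) + w a e, x)`. In these variables everything is smooth, at the poles and at the
equator as well, so there is no cap to be glued to its reflection. `IsProfile` collects what `a`,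
`b`, `T` must satisfy. The shape operator is `(b/a) • 1` plus a rank-one map
(`IsProfile.exists_shapeOperator_eq`), and the principal curvatures are `b / a` and `-a / (2 b')`
(`IsProfile.principalCurvatures_eq`).

The equation of constant `r`-th mean curvature `H` has the first integral
`sin^(n-r) s sin^r θ = c ∫₀ˢ sinⁿ⁻¹ / cosʳ⁻¹` with `c = r H / C(n-1, r-1)`. In terms of `b = cos s`,
the integral is `(1 - b)^(n/2) J(b)`, where `J` (`densityAvg`) is a weighted average of a smooth
function, hence smooth at `b = 1`. Thus `w = W(b) = (1 - b²) / A(b)²` with `A(b)ʳ = (1 + b)^(n/2) / (c J(b))`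
(`sineSq`, `sineRatio`). The differential equation `(1 - b) J' = (n/2) J - density` gives `W'` and
the curvature equation (`IsAdmissible.curvature_eq`), and the estimate `n b J ≤ (1 + b) density` gives
`W' < 0` (`IsAdmissible.deriv_sineSq_neg`). Since `W` vanishes at `b = 1` and exceeds `1` near the
lower end of its domain (`exists_sineSq_eq_one`), it has a smooth inverse `w ↦ b(w)` near `[0, 1]`,
and `a = A ∘ b` completes the profile (`exists_profile`).

The meridian curvature is always positive, so convexity is decided by the sign of the smallest
value `b(1)` of `cos s`, attained at the equator. For `r > 1` the domain of `W` is `b > 0`. For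
`r = 1` it is `b > -1`, and `W(0) = (H S(n))²` (`sineSq_one_zero`), so that `b(1)` has the sign of
`H S(n) - 1`.
-/

noncomputable section

namespace SphereTimesLine

/-! ### Linear algebra of rank-one perturbations of a homothety -/

open Polynomial in
lemma roots_charpoly_smul_one_add_smulRight {V : Type*} [AddCommGroup V] [Module ℝ V]
    [FiniteDimensional ℝ V] (hV : 1 ≤ Module.finrank ℝ V) (c : ℝ) (l : V →ₗ[ℝ] ℝ) (v : V) :
    (c • (1 : Module.End ℝ V) + l.smulRight v).charpoly.roots =
      (c + l v) ::ₘ Multiset.replicate (Module.finrank ℝ V - 1) c := by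
  have h1 : (l.smulRight v).charpoly =
      X ^ Module.finrank ℝ V - l v • X ^ (Module.finrank ℝ V - 1) := by
    let B := Module.finBasis ℝ V
    have hM : LinearMap.toMatrix B B (l.smulRight v) =
        Matrix.vecMulVec (fun i => B.repr v i) (fun j => l (B j)) := by
      ext i j
      simp [LinearMap.toMatrix_apply, Matrix.vecMulVec_apply, mul_comm]
    have hl : (fun i => B.repr v i) ⬝ᵥ (fun j => l (B j)) = l v := by
      conv_rhs => rw [← B.sum_repr v]
      simp only [dotProduct, map_sum, map_smul, smul_eq_mul]
    rw [← LinearMap.charpoly_toMatrix _ B, hM, Matrix.charpoly_vecMulVec, hl, Fintype.card_fin]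
  have h2 : (c • (1 : Module.End ℝ V) + l.smulRight v) = l.smulRight v - (-c) • 1 := by
    rw [neg_smul, sub_neg_eq_add, add_comm]
  obtain ⟨k, hk⟩ : ∃ k, Module.finrank ℝ V = k + 1 := ⟨_, (Nat.sub_add_cancel hV).symm⟩
  have h3 : (c • (1 : Module.End ℝ V) + l.smulRight v).charpoly =
      (X - C (c + l v)) * (X - C c) ^ k := by
    rw [h2, LinearMap.charpoly_sub_smul, h1, hk]
    simp [smul_eq_C_mul, pow_succ]
    ring
  have h4 : (X - C (c + l v)) * (X - C c) ^ k ≠ 0 :=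
    mul_ne_zero (X_sub_C_ne_zero _) (pow_ne_zero _ (X_sub_C_ne_zero _))
  rw [h3, roots_mul h4, roots_pow, roots_X_sub_C, roots_X_sub_C, hk, Multiset.nsmul_singleton,
    Multiset.singleton_add, Nat.add_sub_cancel]

lemma esymm_replicate (m k : ℕ) (c : ℝ) :
    (Multiset.replicate m c).esymm k = (m.choose k : ℝ) * c ^ k := by
  have h : ∀ s ∈ (Multiset.replicate m c).powersetCard k, s.prod = c ^ k := by
    intro s hs
    obtain ⟨h1, h2⟩ := Multiset.mem_powersetCard.1 hs
    have : s = Multiset.replicate k c :=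
      Multiset.eq_replicate.2
        ⟨h2, fun x hx => Multiset.eq_of_mem_replicate (Multiset.mem_of_le h1 hx)⟩
    rw [this, Multiset.prod_replicate]
  rw [Multiset.esymm, Multiset.map_congr rfl h, Multiset.map_const', Multiset.sum_replicate,
    Multiset.card_powersetCard, Multiset.card_replicate, nsmul_eq_mul]

lemma esymm_cons (x : ℝ) (s : Multiset ℝ) (k : ℕ) :
    (x ::ₘ s).esymm (k + 1) = s.esymm (k + 1) + x * s.esymm k := by
  simp only [Multiset.esymm, Multiset.powersetCard_cons, Multiset.map_add, Multiset.sum_add,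
    Multiset.map_map, Function.comp_def, Multiset.prod_cons, Multiset.sum_map_mul_left]

section Geometry

/-! ### Rotational maps -/

/-- The Euclidean space `ℝⁿ⁺¹` containing the sphere `𝕊ⁿ`. -/
abbrev Euc (n : ℕ) : Type := EuclideanSpace ℝ (Fin (n + 1))

/-- The component of `q` orthogonal to the unit vector `e`. -/
def perp {n : ℕ} (e q : Euc n) : Euc n := q - ⟪e, q⟫_ℝ • e

/-- The map `q ↦ (f(w) (q - x e) + g(w) e, T(x))` with `x = ⟪e, q⟫` and `w = 1 - x²`: on the unit
sphere, `q - x e` is the component of `q` orthogonal to the axis and `w` is its squared norm. -/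
def rotMap {n : ℕ} (f g T : ℝ → ℝ) (e q : Euc n) : Amb n :=
  WithLp.toLp 2 (f (1 - ⟪e, q⟫_ℝ ^ 2) • perp e q + g (1 - ⟪e, q⟫_ℝ ^ 2) • e, T ⟪e, q⟫_ℝ)

variable {n : ℕ}

lemma inner_mem_Icc (e p : Sph n) :
    ⟪(e : Euc n), p⟫_ℝ ∈ Set.Icc (-1 : ℝ) 1 := by
  have h := abs_real_inner_le_norm (e : Euc n) p
  rw [norm_eq_of_mem_sphere, norm_eq_of_mem_sphere, one_mul] at h
  exact abs_le.1 h

lemma one_sub_sq_mem_Icc {x : ℝ} (hx : x ∈ Set.Icc (-1 : ℝ) 1) : 1 - x ^ 2 ∈ Set.Icc (0 : ℝ) 1 := by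
  constructor <;> nlinarith [hx.1, hx.2]

lemma contDiffAt_rotMap {f g T : ℝ → ℝ} (e q : Euc n)
    (hf : ContDiffAt ℝ ∞ f (1 - ⟪e, q⟫_ℝ ^ 2)) (hg : ContDiffAt ℝ ∞ g (1 - ⟪e, q⟫_ℝ ^ 2))
    (hT : ContDiffAt ℝ ∞ T ⟪e, q⟫_ℝ) : ContDiffAt ℝ ∞ (rotMap f g T e) q := by
  have hx : ContDiffAt ℝ ∞ (fun q : Euc n => ⟪e, q⟫_ℝ) q :=
    (innerSL ℝ e).contDiff.contDiffAt
  have hw : ContDiffAt ℝ ∞ (fun q : Euc n => 1 - ⟪e, q⟫_ℝ ^ 2) q :=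
    contDiffAt_const.sub (hx.pow 2)
  have h := (((hf.comp q hw).smul (contDiffAt_id.sub (hx.smul (contDiffAt_const (c := e))))).add
    ((hg.comp q hw).smul (contDiffAt_const (c := e)))).prodMk (hT.comp q hx)
  exact (WithLp.prodContinuousLinearEquiv 2 ℝ (Euc n)
    ℝ).symm.contDiff.contDiffAt.comp q h

lemma fderiv_toLp_prodMk {U V W : Type*} [NormedAddCommGroup U] [NormedSpace ℝ U]
    [NormedAddCommGroup V] [NormedSpace ℝ V] [NormedAddCommGroup W] [NormedSpace ℝ W]
    {f : U → V} {g : U → W} {f' : U →L[ℝ] V} {g' : U →L[ℝ] W} {q : U} (hf : HasFDerivAt f f' q)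
    (hg : HasFDerivAt g g' q) (η : U) :
    fderiv ℝ (fun q => WithLp.toLp 2 (f q, g q)) q η = WithLp.toLp 2 (f' η, g' η) := by
  have h := (WithLp.prodContinuousLinearEquiv 2 ℝ V W).symm.hasFDerivAt.comp q (hf.prodMk hg)
  have h' : HasFDerivAt (fun q => WithLp.toLp 2 (f q, g q)) _ q := h
  rw [h'.fderiv]
  rfl

lemma fderiv_rotMap {f g T : ℝ → ℝ} (e q η : Euc n)
    (hf : ContDiffAt ℝ ∞ f (1 - ⟪e, q⟫_ℝ ^ 2)) (hg : ContDiffAt ℝ ∞ g (1 - ⟪e, q⟫_ℝ ^ 2))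
    (hT : ContDiffAt ℝ ∞ T ⟪e, q⟫_ℝ) :
    fderiv ℝ (rotMap f g T e) q η =
      WithLp.toLp 2 (f (1 - ⟪e, q⟫_ℝ ^ 2) • perp e η
        - (2 * ⟪e, q⟫_ℝ * ⟪e, η⟫_ℝ) • (deriv f (1 - ⟪e, q⟫_ℝ ^ 2) • perp e q
          + deriv g (1 - ⟪e, q⟫_ℝ ^ 2) • e), deriv T ⟪e, q⟫_ℝ * ⟪e, η⟫_ℝ) := by
  have hx : HasFDerivAt (fun q : Euc n => ⟪e, q⟫_ℝ) (innerSL ℝ e) q :=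
    (innerSL ℝ e).hasFDerivAt
  have hw := (hx.pow 2).const_sub 1
  have hf' := (hf.differentiableAt (by simp)).hasDerivAt.comp_hasFDerivAt q hw
  have hg' := (hg.differentiableAt (by simp)).hasDerivAt.comp_hasFDerivAt q hw
  have hT' := (hT.differentiableAt (by simp)).hasDerivAt.comp_hasFDerivAt q hx
  have h := (hf'.smul ((hasFDerivAt_id q).sub (hx.smul (hasFDerivAt_const e q)))).add
    (hg'.smul (hasFDerivAt_const e q))
  refine (fderiv_toLp_prodMk h hT' η).trans ?_
  congr 2
  simp [perp]
  module

/-- The differential of the inclusion of the unit sphere in the Euclidean space. -/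
def dIncl (p : Sph n) : TangentSpace (𝓡 n) p →L[ℝ] Euc n :=
  mvfderiv (𝓡 n) ((↑) : Sph n → Euc n) p

/-- The dimension of `ℝⁿ⁺¹`, in the form required by the results on the manifold `𝕊ⁿ`. -/
instance factFinrank : Fact (Module.finrank ℝ (Euc n) = n + 1) :=
  ⟨finrank_euclideanSpace_fin⟩

lemma dIncl_injective (p : Sph n) : Function.Injective (dIncl p) :=
  injective_mvfderiv_subtypeVal_sphere p

lemma exists_dIncl_eq (p : Sph n) {v : Euc n}
    (hv : ⟪(p : Euc n), v⟫_ℝ = 0) : ∃ X, dIncl p X = v := by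
  have h : v ∈ (mvfderiv (𝓡 n) ((↑) : Sph n → Euc n) p).range := by
    rw [range_mvfderiv_subtypeVal]
    exact Submodule.mem_orthogonal_singleton_iff_inner_right.2 hv
  exact h

lemma inner_dIncl (p : Sph n) (X : TangentSpace (𝓡 n) p) :
    ⟪(p : Euc n), dIncl p X⟫_ℝ = 0 := by
  have h : dIncl p X ∈ (mvfderiv (𝓡 n) ((↑) : Sph n → Euc n) p).range :=
    ⟨X, rfl⟩
  rw [range_mvfderiv_subtypeVal] at h
  exact Submodule.mem_orthogonal_singleton_iff_inner_right.1 h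

lemma mvfderiv_comp_coe_sphere {V : Type*} [NormedAddCommGroup V] [NormedSpace ℝ V]
    {G : Euc n → V} (p : Sph n) (hG : DifferentiableAt ℝ G p)
    (X : TangentSpace (𝓡 n) p) :
    mvfderiv (𝓡 n) (fun q : Sph n => G q) p X = fderiv ℝ G p (dIncl p X) := by
  have h := mfderiv_comp_apply (I := 𝓡 n) (I' := 𝓘(ℝ, Euc n))
    (I'' := 𝓘(ℝ, V)) (g := G) (f := ((↑) : Sph n → Euc n)) p
    hG.mdifferentiableAt ((contMDiff_coe_sphere (m := 1) p).mdifferentiableAt one_ne_zero) X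
  rw [mfderiv_eq_fderiv] at h
  exact h

lemma inner_perp {e : Euc n} (he : ‖e‖ = 1) (p : Euc n) : ⟪e, perp e p⟫_ℝ = 0 := by
  rw [perp, inner_sub_right, real_inner_smul_right, real_inner_self_eq_norm_sq, he]
  ring

lemma inner_perp_self {e p : Euc n} (he : ‖e‖ = 1) (hp : ‖p‖ = 1) :
    ⟪perp e p, perp e p⟫_ℝ = 1 - ⟪e, p⟫_ℝ ^ 2 := by
  simp only [perp, inner_sub_left, inner_sub_right, real_inner_smul_right, real_inner_smul_left,
    real_inner_self_eq_norm_sq e, real_inner_self_eq_norm_sq p, he, hp, real_inner_comm e p]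
  ring

lemma inner_perp_add_axis {e p : Euc n} (he : ‖e‖ = 1) (hp : ‖p‖ = 1) (c d c' d' : ℝ) :
    ⟪c • perp e p + d • e, c' • perp e p + d' • e⟫_ℝ
      = c * c' * (1 - ⟪e, p⟫_ℝ ^ 2) + d * d' := by
  simp only [inner_add_left, inner_add_right, real_inner_smul_right, real_inner_smul_left,
    inner_perp_self he hp, inner_perp he, real_inner_self_eq_norm_sq e, he,
    real_inner_comm e (perp e p)]
  ring

lemma inner_perp_add_axis_tangent {e p η : Euc n} (he : ‖e‖ = 1) (c d : ℝ) (hη : ⟪p, η⟫_ℝ = 0) :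
    ⟪c • perp e p + d • e, perp e η⟫_ℝ = - c * ⟪e, p⟫_ℝ * ⟪e, η⟫_ℝ := by
  simp only [perp, inner_add_left, inner_sub_left, inner_sub_right, real_inner_smul_right,
    real_inner_smul_left, real_inner_self_eq_norm_sq e, he, hη, real_inner_comm e p]
  ring

/-! ### The rotational hypersurface of a profile -/

/-- Data of a rotational sphere, parametrized by its Gauss map. The point whose unit normal makes
the angle `θ` with the vertical direction has distance `s` to the axis, and with `x = cos θ`,
`w = sin² θ` one has `a(w) = sin s / sin θ`, `b(w) = cos s`, and height `T(x)`. Only the values of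
`a`, `b` near `[0, 1]` and of `T` near `[-1, 1]` matter. -/
structure IsProfile (a b T : ℝ → ℝ) : Prop where
  contDiffAt_a : ∀ w ∈ Set.Icc (0 : ℝ) 1, ContDiffAt ℝ ∞ a w
  contDiffAt_b : ∀ w ∈ Set.Icc (0 : ℝ) 1, ContDiffAt ℝ ∞ b w
  contDiffAt_T : ∀ x ∈ Set.Icc (-1 : ℝ) 1, ContDiffAt ℝ ∞ T x
  a_pos : ∀ w ∈ Set.Icc (0 : ℝ) 1, 0 < a w
  deriv_b_neg : ∀ w ∈ Set.Icc (0 : ℝ) 1, deriv b w < 0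
  sphere_eq : ∀ w ∈ Set.Icc (0 : ℝ) 1, w * a w ^ 2 + b w ^ 2 = 1
  deriv_sphere_eq : ∀ w ∈ Set.Icc (0 : ℝ) 1,
    a w ^ 2 + 2 * w * a w * deriv a w + 2 * b w * deriv b w = 0
  deriv_T : ∀ x ∈ Set.Icc (-1 : ℝ) 1, deriv T x = 2 * deriv b (1 - x ^ 2) / a (1 - x ^ 2)
  T_neg : ∀ x ∈ Set.Icc (-1 : ℝ) 1, T (-x) = - T x

variable {a b T : ℝ → ℝ}

namespace IsProfile

lemma fst_mem_sphere (h : IsProfile a b T) (e p : Sph n) :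
    (rotMap a b T (e : Euc n) p).fst ∈ Metric.sphere (0 : Euc n) 1 := by
  rw [mem_sphere_zero_iff_norm, ← pow_eq_one_iff_of_nonneg (norm_nonneg _) two_ne_zero,
    ← real_inner_self_eq_norm_sq]
  refine (inner_perp_add_axis (norm_eq_of_mem_sphere e) (norm_eq_of_mem_sphere p) _ _ _ _).trans ?_
  have := h.sphere_eq _ (one_sub_sq_mem_Icc (inner_mem_Icc e p))
  linear_combination this

/-- The rotational sphere of a profile. -/
def sphereMap (h : IsProfile a b T) (e p : Sph n) : Sph n × ℝ :=
  (⟨(rotMap a b T (e : Euc n) p).fst, h.fst_mem_sphere e p⟩, T ⟪(e : Euc n), p⟫_ℝ)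

end IsProfile

/-- The unit normal of the rotational sphere of a profile. It points inwards, so that the meridians
have positive curvature. -/
def profileNormal (a b : ℝ → ℝ) (e p : Sph n) : Amb n :=
  rotMap (fun w => - b w) (fun w => w * a w) id (e : Euc n) p

namespace IsProfile

variable (h : IsProfile a b T) (e : Sph n)
include h

lemma contDiffAt_rotMap (p : Sph n) : ContDiffAt ℝ ∞ (rotMap a b T (e : Euc n)) p :=
  SphereTimesLine.contDiffAt_rotMap _ _ (h.contDiffAt_a _ (one_sub_sq_mem_Icc (inner_mem_Icc e p)))
    (h.contDiffAt_b _ (one_sub_sq_mem_Icc (inner_mem_Icc e p)))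
    (h.contDiffAt_T _ (inner_mem_Icc e p))

lemma contDiffAt_mul_a (p : Sph n) :
    ContDiffAt ℝ ∞ (fun w => w * a w) (1 - ⟪(e : Euc n), p⟫_ℝ ^ 2) :=
  contDiffAt_id.mul (h.contDiffAt_a _ (one_sub_sq_mem_Icc (inner_mem_Icc e p)))

lemma contDiffAt_neg_b (p : Sph n) :
    ContDiffAt ℝ ∞ (fun w => - b w) (1 - ⟪(e : Euc n), p⟫_ℝ ^ 2) :=
  (h.contDiffAt_b _ (one_sub_sq_mem_Icc (inner_mem_Icc e p))).neg

lemma diff_sphereMap (p : Sph n) (X : TangentSpace (𝓡 n) p) :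
    diff (h.sphereMap e) p X =
      WithLp.toLp 2 (a (1 - ⟪(e : Euc n), p⟫_ℝ ^ 2) • perp (e : Euc n) (dIncl p X)
        - (2 * ⟪(e : Euc n), p⟫_ℝ * ⟪(e : Euc n), dIncl p X⟫_ℝ) •
          (deriv a (1 - ⟪(e : Euc n), p⟫_ℝ ^ 2) • perp (e : Euc n) p
            + deriv b (1 - ⟪(e : Euc n), p⟫_ℝ ^ 2) • (e : Euc n)),
        deriv T ⟪(e : Euc n), p⟫_ℝ * ⟪(e : Euc n), dIncl p X⟫_ℝ) :=
  (mvfderiv_comp_coe_sphere p ((h.contDiffAt_rotMap e p).differentiableAt (by simp)) X).trans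
    (fderiv_rotMap _ _ _ (h.contDiffAt_a _ (one_sub_sq_mem_Icc (inner_mem_Icc e p)))
    (h.contDiffAt_b _ (one_sub_sq_mem_Icc (inner_mem_Icc e p)))
    (h.contDiffAt_T _ (inner_mem_Icc e p)))

lemma mvfderiv_profileNormal (p : Sph n) (X : TangentSpace (𝓡 n) p) :
    mvfderiv (𝓡 n) (profileNormal a b e) p X =
      WithLp.toLp 2 (- b (1 - ⟪(e : Euc n), p⟫_ℝ ^ 2) • perp (e : Euc n) (dIncl p X)
        - (2 * ⟪(e : Euc n), p⟫_ℝ * ⟪(e : Euc n), dIncl p X⟫_ℝ) •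
          (- deriv b (1 - ⟪(e : Euc n), p⟫_ℝ ^ 2) • perp (e : Euc n) p
            + (a (1 - ⟪(e : Euc n), p⟫_ℝ ^ 2) + (1 - ⟪(e : Euc n), p⟫_ℝ ^ 2) *
              deriv a (1 - ⟪(e : Euc n), p⟫_ℝ ^ 2)) • (e : Euc n)),
        ⟪(e : Euc n), dIncl p X⟫_ℝ) := by
  have h1 := h.contDiffAt_neg_b e p
  have h2 := h.contDiffAt_mul_a e p
  refine (mvfderiv_comp_coe_sphere p ((SphereTimesLine.contDiffAt_rotMap _ _ h1 h2
    contDiffAt_id).differentiableAt (by simp)) X).trans ?_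
  rw [fderiv_rotMap _ _ _ h1 h2 contDiffAt_id, deriv_id, one_mul, deriv.fun_neg,
    deriv_fun_mul differentiableAt_fun_id ((h.contDiffAt_a _
      (one_sub_sq_mem_Icc (inner_mem_Icc e p))).differentiableAt (by simp)), deriv_id'', one_mul]

lemma deriv_T_neg {x : ℝ} (hx : x ∈ Set.Icc (-1 : ℝ) 1) : deriv T x < 0 := by
  rw [h.deriv_T x hx]
  exact div_neg_of_neg_of_pos (by linarith [h.deriv_b_neg _ (one_sub_sq_mem_Icc hx)])
    (h.a_pos _ (one_sub_sq_mem_Icc hx))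

lemma strictAntiOn_T : StrictAntiOn T (Set.Icc (-1) 1) :=
  strictAntiOn_of_deriv_neg (convex_Icc _ _)
    (fun x hx => (h.contDiffAt_T x hx).continuousAt.continuousWithinAt)
    fun _ hx => h.deriv_T_neg (interior_subset hx)

lemma diff_injective (p : Sph n) : Function.Injective (diff (h.sphereMap e) p) := by
  rw [injective_iff_map_eq_zero]
  intro X hX
  rw [h.diff_sphereMap e p X] at hX
  have hT := (h.deriv_T_neg (inner_mem_Icc e p)).ne
  have ha := (h.a_pos _ (one_sub_sq_mem_Icc (inner_mem_Icc e p))).ne'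
  have h2 : deriv T ⟪(e : Euc n), p⟫_ℝ * ⟪(e : Euc n), dIncl p X⟫_ℝ = 0 :=
    congrArg WithLp.snd hX
  have h3 := (mul_eq_zero.1 h2).resolve_left hT
  have h1 := congrArg WithLp.fst hX
  simp only [perp, h3, mul_zero, zero_smul, sub_zero] at h1
  exact dIncl_injective p (((smul_eq_zero.1 h1).resolve_left ha).trans (map_zero (dIncl p)).symm)

lemma contMDiff_sphereMap : ContMDiff (𝓡 n) ((𝓡 n).prod 𝓘(ℝ, ℝ)) ∞ (h.sphereMap e) := by
  have h0 : ContMDiff (𝓡 n) 𝓘(ℝ, Amb n) ∞ (fun p : Sph n => rotMap a b T (e : Euc n) p) :=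
    fun p => ((h.contDiffAt_rotMap e p).contMDiffAt (n := ∞)).comp p
      contMDiff_coe_sphere.contMDiffAt
  have h1 : ContMDiff (𝓡 n) 𝓘(ℝ, Euc n) ∞ (fun p : Sph n => (rotMap a b T (e : Euc n) p).fst) :=
    (WithLp.fstL 2 ℝ (Euc n) ℝ).contDiff.contMDiff.comp h0
  have h2 : ContMDiff (𝓡 n) 𝓘(ℝ, ℝ) ∞ (fun p : Sph n => (rotMap a b T (e : Euc n) p).snd) :=
    (WithLp.sndL 2 ℝ (Euc n) ℝ).contDiff.contMDiff.comp h0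
  exact (h1.codRestrict_sphere (h.fst_mem_sphere e)).prodMk h2

lemma sphereMap_injective : Function.Injective (h.sphereMap e) := by
  intro p q hpq
  have h2 : ⟪(e : Euc n), p⟫_ℝ = ⟪(e : Euc n), q⟫_ℝ :=
    h.strictAntiOn_T.injOn (inner_mem_Icc e p) (inner_mem_Icc e q) (congrArg Prod.snd hpq)
  have h1 : (rotMap a b T (e : Euc n) p).fst = (rotMap a b T (e : Euc n) q).fst :=
    congrArg (fun z => (z.1 : Euc n)) hpq
  have ha := (h.a_pos _ (one_sub_sq_mem_Icc (inner_mem_Icc e q))).ne'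
  simp only [rotMap, perp, h2] at h1
  exact Subtype.ext (sub_left_injective (smul_right_injective _ ha (add_right_cancel h1)))

lemma isEmbeddedHypersurface : IsEmbeddedHypersurface (h.sphereMap (n := n) e) where
  smooth := h.contMDiff_sphereMap e
  immersion p := by
    have hincl : ContMDiff ((𝓡 n).prod 𝓘(ℝ, ℝ)) 𝓘(ℝ, Amb n) ∞ (incl (n := n)) :=
      (WithLp.prodContinuousLinearEquiv 2 ℝ (Euc n) ℝ).symm.contDiff.contMDiff.comp
        ((contMDiff_coe_sphere.comp contMDiff_fst).prodMk_space contMDiff_snd)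
    have hc := mfderiv_comp p (hincl.mdifferentiableAt (by simp) (x := h.sphereMap e p))
      ((h.contMDiff_sphereMap e).mdifferentiableAt (by simp) (x := p))
    have hd : Function.Injective (mfderiv (𝓡 n) 𝓘(ℝ, Amb n) (incl ∘ h.sphereMap e) p) :=
      h.diff_injective e p
    rw [hc] at hd
    exact Function.Injective.of_comp hd
  isEmbedding := ((h.contMDiff_sphereMap e).continuous.isClosedEmbedding
    (h.sphereMap_injective e)).isEmbedding

end IsProfile

lemma norm_outer (z : Sph n × ℝ) : ‖outer z‖ = 1 := by
  have h1 : ‖(outer z)‖ ^ 2 = 1 := by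
    rw [WithLp.prod_norm_sq_eq_of_L2]
    simp [outer]
  exact (pow_eq_one_iff_of_nonneg (norm_nonneg _) two_ne_zero).1 h1

namespace IsProfile

variable (h : IsProfile a b T) (e : Sph n)
include h

lemma inner_outer_profileNormal (p : Sph n) :
    ⟪outer (h.sphereMap e p), profileNormal a b e p⟫_ℝ = 0 := by
  rw [WithLp.prod_inner_apply]
  refine (congrArg₂ (· + ·) (inner_perp_add_axis (norm_eq_of_mem_sphere e)
    (norm_eq_of_mem_sphere p) _ _ _ _) (inner_zero_left _)).trans ?_
  ring

lemma isUnitNormal : IsUnitNormal (h.sphereMap e) (profileNormal a b e) where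
  smooth p := by
    have h1 := SphereTimesLine.contDiffAt_rotMap (T := id) _ _ (h.contDiffAt_neg_b e p)
      (h.contDiffAt_mul_a e p) contDiffAt_id
    exact (h1.contMDiffAt (n := ∞)).comp p contMDiff_coe_sphere.contMDiffAt
  mem_ambTangent p :=
    Submodule.mem_orthogonal_singleton_iff_inner_right.2 (h.inner_outer_profileNormal e p)
  orthogonal p X := by
    have hw := one_sub_sq_mem_Icc (inner_mem_Icc e p)
    have h1 := inner_perp_add_axis_tangent (e := (e : Euc n)) (norm_eq_of_mem_sphere e)
      (- b (1 - ⟪(e : Euc n), p⟫_ℝ ^ 2))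
      ((1 - ⟪(e : Euc n), p⟫_ℝ ^ 2) * a (1 - ⟪(e : Euc n), p⟫_ℝ ^ 2))
      (inner_dIncl p X)
    have h2 := inner_perp_add_axis (e := (e : Euc n)) (p := p) (norm_eq_of_mem_sphere e)
      (norm_eq_of_mem_sphere p)
      (- b (1 - ⟪(e : Euc n), p⟫_ℝ ^ 2))
      ((1 - ⟪(e : Euc n), p⟫_ℝ ^ 2) * a (1 - ⟪(e : Euc n), p⟫_ℝ ^ 2))
      (deriv a (1 - ⟪(e : Euc n), p⟫_ℝ ^ 2)) (deriv b (1 - ⟪(e : Euc n), p⟫_ℝ ^ 2))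
    have hT := h.deriv_T _ (inner_mem_Icc e p)
    have ha := (h.a_pos _ hw).ne'
    rw [h.diff_sphereMap, WithLp.prod_inner_apply]
    simp only [profileNormal, rotMap, id]
    rw [inner_sub_right, real_inner_smul_right, real_inner_smul_right, h1, h2, hT]
    have h3 := h.sphere_eq _ hw
    have h4 := h.deriv_sphere_eq _ hw
    rw [Real.inner_apply]
    generalize ⟪(e : Euc n), dIncl p X⟫_ℝ = ξ
    generalize ⟪(e : Euc n), p⟫_ℝ = x at *
    generalize 1 - x ^ 2 = w at *
    field_simp
    linear_combination (x * ξ) * (b w * h4 - 2 * deriv b w * h3)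
  norm_eq_one p := by
    rw [← pow_eq_one_iff_of_nonneg (norm_nonneg _) two_ne_zero,
      ← real_inner_self_eq_norm_sq, WithLp.prod_inner_apply]
    have h2 := inner_perp_add_axis (e := (e : Euc n)) (p := p) (norm_eq_of_mem_sphere e)
      (norm_eq_of_mem_sphere p)
      (- b (1 - ⟪(e : Euc n), p⟫_ℝ ^ 2))
      ((1 - ⟪(e : Euc n), p⟫_ℝ ^ 2) * a (1 - ⟪(e : Euc n), p⟫_ℝ ^ 2))
      (- b (1 - ⟪(e : Euc n), p⟫_ℝ ^ 2))
      ((1 - ⟪(e : Euc n), p⟫_ℝ ^ 2) * a (1 - ⟪(e : Euc n), p⟫_ℝ ^ 2))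
    have h3 := h.sphere_eq _ (one_sub_sq_mem_Icc (inner_mem_Icc e p))
    simp only [profileNormal, rotMap, id]
    rw [h2, real_inner_self_eq_norm_sq ⟪(e : Euc n), p⟫_ℝ, Real.norm_eq_abs, sq_abs]
    linear_combination (1 - ⟪(e : Euc n), p⟫_ℝ ^ 2) * h3

lemma isSymmetricAbout : IsSymmetricAbout (h.sphereMap e) 0 := by
  -- The reflection `p ↦ p - 2 x e` of the sphere covers the reflection of its image.
  have hn : ∀ p : Sph n, ∃ q : Sph n,
      h.sphereMap e q = ((h.sphereMap e p).1, - (h.sphereMap e p).2) := by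
    intro p
    have he : ‖(e : Euc n)‖ = 1 := norm_eq_of_mem_sphere e
    have hp : ‖(p : Euc n)‖ = 1 := norm_eq_of_mem_sphere p
    have hq : ‖(p : Euc n) - (2 * ⟪(e : Euc n), p⟫_ℝ) • (e : Euc n)‖ = 1 := by
      rw [← pow_eq_one_iff_of_nonneg (norm_nonneg _) two_ne_zero, ← real_inner_self_eq_norm_sq]
      simp only [inner_sub_left, inner_sub_right, real_inner_smul_right, real_inner_smul_left,
        real_inner_self_eq_norm_sq (e : Euc n), real_inner_self_eq_norm_sq (p : Euc n), he, hp,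
        real_inner_comm (e : Euc n) p]
      ring
    have hx : ⟪(e : Euc n), (p : Euc n) - (2 * ⟪(e : Euc n), p⟫_ℝ) • (e : Euc n)⟫_ℝ =
        - ⟪(e : Euc n), p⟫_ℝ := by
      rw [inner_sub_right, real_inner_smul_right, real_inner_self_eq_norm_sq, he]
      ring
    refine ⟨⟨(p : Euc n) - (2 * ⟪(e : Euc n), p⟫_ℝ) • (e : Euc n), by
      rw [mem_sphere_zero_iff_norm]; exact hq⟩, Prod.ext (Subtype.ext ?_) ?_⟩
    · have hperp : perp (e : Euc n) ((p : Euc n) - (2 * ⟪(e : Euc n), p⟫_ℝ) • (e : Euc n)) =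
          perp (e : Euc n) p := by
        simp only [perp, hx]
        module
      simp only [sphereMap, rotMap, hx, neg_sq, hperp]
      rfl
    · simp only [sphereMap, hx]
      exact h.T_neg _ (inner_mem_Icc e p)
  intro x t
  rw [mul_zero, zero_sub]
  constructor
  · rintro ⟨p, hp⟩
    obtain ⟨q, hq⟩ := hn p
    exact ⟨q, by rw [hq, hp]⟩
  · rintro ⟨p, hp⟩
    obtain ⟨q, hq⟩ := hn p
    exact ⟨q, by rw [hq, hp, neg_neg]⟩

lemma isRotational : IsRotational (h.sphereMap e) := by
  refine ⟨e, fun t ht z hz => ?_⟩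
  obtain ⟨⟨p, rfl⟩, hp⟩ := hz
  have hp' : T ⟪(e : Euc n), p⟫_ℝ = t := hp
  set x := ⟪(e : Euc n), p⟫_ℝ with hx
  have hxI := inner_mem_Icc e p
  have he : ‖(e : Euc n)‖ = 1 := norm_eq_of_mem_sphere e
  have hpn : ‖(p : Euc n)‖ = 1 := norm_eq_of_mem_sphere p
  -- At a pole the tangent plane is horizontal, so a transversal section avoids the poles.
  have hw : 0 < 1 - x ^ 2 := by
    refine lt_of_le_of_ne (one_sub_sq_mem_Icc hxI).1 fun h0 => ?_
    obtain ⟨X, hX⟩ := ht p hp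
    rw [h.diff_sphereMap] at hX
    have h1 : perp (e : Euc n) p = 0 := by
      rw [← inner_self_eq_zero (𝕜 := ℝ), inner_perp_self he hpn]
      exact h0.symm
    have h2 : (p : Euc n) = x • (e : Euc n) := sub_eq_zero.1 h1
    have h3 := inner_dIncl p X
    rw [h2, real_inner_smul_left] at h3
    have h4 : x ≠ 0 := by rintro h5; rw [h5] at h0; norm_num at h0
    rw [(mul_eq_zero.1 h3).resolve_left h4] at hX
    exact hX (mul_zero _)
  have hb : b (1 - x ^ 2) ^ 2 < 1 := by
    have h1 := h.sphere_eq _ (one_sub_sq_mem_Icc hxI)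
    have h2 := h.a_pos _ (one_sub_sq_mem_Icc hxI)
    have h3 : 0 < (1 - x ^ 2) * a (1 - x ^ 2) ^ 2 := by positivity
    linarith
  have hb' := abs_lt.1 ((sq_lt_one_iff_abs_lt_one _).1 hb)
  refine ⟨Real.arccos (b (1 - x ^ 2)), ⟨Real.arccos_pos.2 hb'.2,
    lt_of_le_of_ne (Real.arccos_le_pi _) fun h0 => ?_⟩, (connectedComponentIn_subset _ _).trans ?_⟩
  · rw [Real.arccos_eq_pi] at h0
    linarith [hb'.1]
  · rintro _ ⟨⟨q, rfl⟩, hq⟩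
    refine ⟨?_, hq⟩
    have hq' : T ⟪(e : Euc n), q⟫_ℝ = t := hq
    have hqx : ⟪(e : Euc n), q⟫_ℝ = x :=
      h.strictAntiOn_T.injOn (inner_mem_Icc e q) hxI (hq'.trans hp'.symm)
    have h1 : ‖((h.sphereMap e q).1 : Euc n)‖ = 1 := norm_eq_of_mem_sphere _
    have h2 : ⟪(e : Euc n), (h.sphereMap e q).1⟫_ℝ = b (1 - x ^ 2) := by
      simp only [sphereMap, rotMap, hqx]
      refine (inner_add_right _ _ _).trans ?_
      rw [ real_inner_smul_right, real_inner_smul_right, inner_perp he,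
        real_inner_self_eq_norm_sq, he]
      ring
    rw [InnerProductGeometry.angle, h1, h2, he, mul_one, div_one]

/-- The shape operator is a homothety of ratio `b/a`, the curvature of the parallels, plus a
rank-one endomorphism accounting for the meridian direction. -/
lemma exists_shapeOperator_eq (p : Sph n) :
    ∃ v : EuclideanSpace ℝ (Fin n), ∃ l : EuclideanSpace ℝ (Fin n) →ₗ[ℝ] ℝ,
      shapeOperator (h.sphereMap e) (profileNormal a b e) p =
        (b (1 - ⟪(e : Euc n), p⟫_ℝ ^ 2) / a (1 - ⟪(e : Euc n), p⟫_ℝ ^ 2)) • 1 + l.smulRight v ∧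
      b (1 - ⟪(e : Euc n), p⟫_ℝ ^ 2) / a (1 - ⟪(e : Euc n), p⟫_ℝ ^ 2) + l v =
        - a (1 - ⟪(e : Euc n), p⟫_ℝ ^ 2) / (2 * deriv b (1 - ⟪(e : Euc n), p⟫_ℝ ^ 2)) := by
  have he : ‖(e : Euc n)‖ = 1 := norm_eq_of_mem_sphere e
  have hpn : ‖(p : Euc n)‖ = 1 := norm_eq_of_mem_sphere p
  have hw := one_sub_sq_mem_Icc (inner_mem_Icc e p)
  have ha := (h.a_pos _ hw).ne'
  have hb := (h.deriv_b_neg _ hw).ne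
  have h3 := h.sphere_eq _ hw
  have h4 := h.deriv_sphere_eq _ hw
  have hT := h.deriv_T _ (inner_mem_Icc e p)
  have hinj : LinearMap.ker
      (diff (h.sphereMap e) p : EuclideanSpace ℝ (Fin n) →L[ℝ] Amb n).toLinearMap = ⊥ :=
    LinearMap.ker_eq_bot.2 (h.diff_injective e p)
  set x := ⟪(e : Euc n), p⟫_ℝ with hx
  set w := 1 - x ^ 2 with hwdef
  set m := deriv a w / deriv b w with hm
  -- The meridian direction at `p` is the gradient `e - x p` of the latitude `x`. The factor
  -- `m = a' / b'` makes `b / a + m w` equal to the meridian curvature, also at the poles.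
  obtain ⟨v, hv⟩ := exists_dIncl_eq p (v := m • ((e : Euc n) - x • (p : Euc n))) (by
    rw [real_inner_smul_right, inner_sub_right, real_inner_smul_right, real_inner_self_eq_norm_sq,
      hpn, real_inner_comm, ← hx]
    ring)
  have hlv : ⟪(e : Euc n), dIncl p v⟫_ℝ = m * w := by
    rw [hv, real_inner_smul_right, inner_sub_right, real_inner_smul_right,
      real_inner_self_eq_norm_sq, he, ← hx, hwdef]
    ring
  have hmu : b w / a w + m * w = - a w / (2 * deriv b w) := by
    rw [hm]
    field_simp
    linear_combination h4
  refine ⟨v,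
    ((innerSL ℝ (e : Euc n)) ∘L (dIncl p : EuclideanSpace ℝ (Fin n) →L[ℝ] Euc n)).toLinearMap, ?_,
    (congrArg (b w / a w + ·) hlv).trans hmu⟩
  -- The outer component of the derivative of the normal field.
  have hout : ∀ X : TangentSpace (𝓡 n) p,
      ⟪outer (h.sphereMap e p), mvfderiv (𝓡 n) (profileNormal a b e) p X⟫_ℝ =
        2 * deriv b w / a w * x * ⟪(e : Euc n), dIncl p X⟫_ℝ := by
    intro X
    have h1 := inner_perp_add_axis_tangent (e := (e : Euc n)) he (a w) (b w) (inner_dIncl p X)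
    have h2 := inner_perp_add_axis (e := (e : Euc n)) (p := p) he hpn (a w) (b w)
      (- deriv b w) (a w + w * deriv a w)
    rw [h.mvfderiv_profileNormal, WithLp.prod_inner_apply]
    refine (congrArg₂ (· + ·) ((inner_sub_right _ _ _).trans (congrArg₂ (· - ·)
      ((real_inner_smul_right _ _ _).trans (congrArg (- b w * ·) h1))
      ((real_inner_smul_right _ _ _).trans (congrArg (_ * ·) h2)))) (inner_zero_left _)).trans ?_
    rw [← hx, ← hwdef]
    generalize ⟪(e : Euc n), dIncl p X⟫_ℝ = ξ
    field_simp
    linear_combination (x * ξ) * (2 * deriv b w * h3 - b w * h4)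
  have key : ∀ X : TangentSpace (𝓡 n) p, covDeriv (h.sphereMap e) (profileNormal a b e) p X =
      - diff (h.sphereMap e) p ((b w / a w) • X + ⟪(e : Euc n), dIncl p X⟫_ℝ • v) := by
    intro X
    have hc : covDeriv (h.sphereMap e) (profileNormal a b e) p X =
        mvfderiv (𝓡 n) (profileNormal a b e) p X -
          (2 * deriv b w / a w * x * ⟪(e : Euc n), dIncl p X⟫_ℝ) • outer (h.sphereMap e p) := by
      rw [← hout]
      change ((ℝ ∙ outer (h.sphereMap e p))ᗮ).starProjection
        (mvfderiv (𝓡 n) (profileNormal a b e) p X) = _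
      rw [Submodule.starProjection_orthogonal_val,
        Submodule.starProjection_unit_singleton ℝ (norm_outer _)]
    have h6 : ⟪(e : Euc n), dIncl p ((b w / a w) • X + ⟪(e : Euc n), dIncl p X⟫_ℝ • v)⟫_ℝ =
        - a w / (2 * deriv b w) * ⟪(e : Euc n), dIncl p X⟫_ℝ := by
      rw [map_add, map_smul, map_smul, inner_add_right, real_inner_smul_right,
        real_inner_smul_right, hlv, ← hmu]
      ring
    have h7 : perp (e : Euc n) (dIncl p ((b w / a w) • X + ⟪(e : Euc n), dIncl p X⟫_ℝ • v)) =
        (b w / a w) • perp (e : Euc n) (dIncl p X)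
          - (⟪(e : Euc n), dIncl p X⟫_ℝ * m * x) • perp (e : Euc n) p := by
      rw [perp, h6, ← hmu, map_add, map_smul, map_smul, hv]
      simp only [perp, ← hx, hwdef]
      module
    rw [hc, h.mvfderiv_profileNormal, h.diff_sphereMap, h6, h7, hT]
    generalize ⟪(e : Euc n), dIncl p X⟫_ℝ = ξ
    generalize perp (e : Euc n) (dIncl p X) = η
    refine congrArg (WithLp.toLp 2) (Prod.ext ?_ ?_)
    · change (-b w • η - (2 * x * ξ) • (-deriv b w • perp (e : Euc n) p
        + (a w + w * deriv a w) • (e : Euc n)))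
        - (2 * deriv b w / a w * x * ξ) • (a w • perp (e : Euc n) p + b w • (e : Euc n))
        = -(a w • ((b w / a w) • η - (ξ * m * x) • perp (e : Euc n) p)
        - (2 * x * (- a w / (2 * deriv b w) * ξ)) • (deriv a w • perp (e : Euc n) p
        + deriv b w • (e : Euc n)))
      have c1 : a w * (b w / a w) = b w := by field_simp
      have c2 : deriv b w / a w * a w = deriv b w := by field_simp
      have c3 : a w * m + 2 * (- a w / (2 * deriv b w)) * deriv a w = 0 := by
        rw [hm]; field_simp; ring
      have c4 : 2 * (a w + w * deriv a w) + 2 * deriv b w / a w * b w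
          + 2 * (- a w / (2 * deriv b w)) * deriv b w = 0 := by
        field_simp; linear_combination h4
      linear_combination (norm := module)
        c1 • η - (2 * x * ξ * c2 + x * ξ * c3) • perp (e : Euc n) p
        - (x * ξ * c4) • (e : Euc n)
    · change ξ - (2 * deriv b w / a w * x * ξ) * 0 =
        -(2 * deriv b w / a w * (- a w / (2 * deriv b w) * ξ))
      field_simp
      ring
  refine LinearMap.ext fun X => ?_
  have h5 : shapeOperator (h.sphereMap e) (profileNormal a b e) p X =
    -((diff (h.sphereMap e) p : EuclideanSpace ℝ (Fin n) →L[ℝ] Amb n).toLinearMap.leftInverse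
      (covDeriv (h.sphereMap e) (profileNormal a b e) p X)) := rfl
  refine h5.trans ((congrArg (fun y => -((diff (h.sphereMap e) p :
    EuclideanSpace ℝ (Fin n) →L[ℝ] Amb n).toLinearMap.leftInverse y)) (key X)).trans ?_)
  rw [map_neg, neg_neg]
  exact LinearMap.leftInverse_apply_of_inj hinj _

end IsProfile

/-! ### Curvature and convexity of the rotational sphere of a profile -/

namespace IsProfile

variable (h : IsProfile a b T) (e : Sph n)
include h

lemma principalCurvatures_eq (hn : 1 ≤ n) (p : Sph n) {w : ℝ}
    (hw : w = 1 - ⟪(e : Euc n), p⟫_ℝ ^ 2) :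
    principalCurvatures (h.sphereMap e) (profileNormal a b e) p =
      (-(a w) / (2 * deriv b w)) ::ₘ Multiset.replicate (n - 1) (b w / a w) := by
  obtain ⟨v, l, h1, h2⟩ := h.exists_shapeOperator_eq e p
  rw [← hw] at h1 h2
  have h3 := roots_charpoly_smul_one_add_smulRight
    (by rw [finrank_euclideanSpace_fin]; exact hn) (b w / a w) l v
  rw [principalCurvatures, h1, h3, h2, finrank_euclideanSpace_fin]

lemma meanCurvature_eq (hn : 1 ≤ n) {r : ℕ} (hr : 1 ≤ r) (p : Sph n) {w : ℝ}
    (hw : w = 1 - ⟪(e : Euc n), p⟫_ℝ ^ 2) :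
    meanCurvature (h.sphereMap e) (profileNormal a b e) r p =
      ((n - 1).choose r : ℝ) * (b w / a w) ^ r +
        ((n - 1).choose (r - 1) : ℝ) * (b w / a w) ^ (r - 1) * (-(a w) / (2 * deriv b w)) := by
  obtain ⟨k, rfl⟩ : ∃ k, r = k + 1 := ⟨r - 1, (Nat.sub_add_cancel hr).symm⟩
  rw [meanCurvature, h.principalCurvatures_eq e hn p hw, esymm_cons, esymm_replicate,
    esymm_replicate, Nat.add_sub_cancel]
  ring

lemma meridian_curvature_pos {w : ℝ} (hw : w ∈ Set.Icc (0 : ℝ) 1) :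
    0 < -(a w) / (2 * deriv b w) :=
  div_pos_of_neg_of_neg (neg_lt_zero.2 (h.a_pos w hw))
    (mul_neg_of_pos_of_neg two_pos (h.deriv_b_neg w hw))

lemma b_one_le {w : ℝ} (hw : w ∈ Set.Icc (0 : ℝ) 1) : b 1 ≤ b w :=
  (strictAntiOn_of_deriv_neg (convex_Icc 0 1)
    (fun x hx => (h.contDiffAt_b x hx).continuousAt.continuousWithinAt)
    fun x hx => h.deriv_b_neg x (interior_subset hx)).antitoneOn hw ⟨zero_le_one, le_rfl⟩ hw.2

lemma isConvex (hn : 1 ≤ n) (hb : 0 ≤ b 1) :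
    IsConvex (h.sphereMap e) (profileNormal a b e) := by
  intro p
  have hw := one_sub_sq_mem_Icc (inner_mem_Icc e p)
  have hpos : ∀ k ∈ principalCurvatures (h.sphereMap e) (profileNormal a b e) p, k ≠ 0 → 0 < k := by
    intro k hk hk0
    rw [h.principalCurvatures_eq e hn p rfl, Multiset.mem_cons] at hk
    rcases hk with rfl | hk
    · exact h.meridian_curvature_pos hw
    · rw [Multiset.eq_of_mem_replicate hk] at hk0 ⊢
      exact lt_of_le_of_ne (div_nonneg (hb.trans (h.b_one_le hw)) (h.a_pos _ hw).le) hk0.symm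
  intro k hk m hm hk0 hm0
  rw [sign_pos (hpos k hk hk0), sign_pos (hpos m hm hm0)]

lemma isStrictlyConvex (hn : 1 ≤ n) (hb : 0 < b 1) :
    IsStrictlyConvex (h.sphereMap e) (profileNormal a b e) := by
  refine fun p => ⟨h.isConvex e hn hb.le p, fun k hk => ?_⟩
  have hw := one_sub_sq_mem_Icc (inner_mem_Icc e p)
  rw [h.principalCurvatures_eq e hn p rfl, Multiset.mem_cons] at hk
  rcases hk with rfl | hk
  · exact (h.meridian_curvature_pos hw).ne'
  · rw [Multiset.eq_of_mem_replicate hk]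
    exact (div_pos (hb.trans_le (h.b_one_le hw)) (h.a_pos _ hw)).ne'

lemma principalCurvatures_equator (hn : 1 ≤ n) {p : Sph n} (hp : ⟪(e : Euc n), p⟫_ℝ = 0) :
    principalCurvatures (h.sphereMap e) (profileNormal a b e) p =
      (-(a 1) / (2 * deriv b 1)) ::ₘ Multiset.replicate (n - 1) (b 1 / a 1) :=
  h.principalCurvatures_eq e hn p (by rw [hp]; norm_num)

lemma not_isStrictlyConvex (hn : 2 ≤ n) (hb : b 1 = 0) {p : Sph n} (hp : ⟪(e : Euc n), p⟫_ℝ = 0) :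
    ¬ IsStrictlyConvex (h.sphereMap e) (profileNormal a b e) := by
  intro hs
  refine (hs p).2 0 ?_ rfl
  rw [h.principalCurvatures_equator e (by omega) hp, hb, zero_div]
  exact Multiset.mem_cons_of_mem (Multiset.mem_replicate.2 ⟨by omega, rfl⟩)

lemma not_isConvex (hn : 2 ≤ n) (hb : b 1 < 0) {p : Sph n} (hp : ⟪(e : Euc n), p⟫_ℝ = 0) :
    ¬ IsConvex (h.sphereMap e) (profileNormal a b e) := by
  intro hc
  have h1 : (1 : ℝ) ∈ Set.Icc (0 : ℝ) 1 := ⟨zero_le_one, le_rfl⟩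
  have hmu := h.meridian_curvature_pos h1
  have hka : b 1 / a 1 < 0 := div_neg_of_neg_of_pos hb (h.a_pos 1 h1)
  have hP := h.principalCurvatures_equator e (by omega : 1 ≤ n) hp
  have hs := hc p _ (by rw [hP]; exact Multiset.mem_cons_self _ _) (b 1 / a 1) (by
    rw [hP]
    exact Multiset.mem_cons_of_mem (Multiset.mem_replicate.2 ⟨by omega, rfl⟩)) hmu.ne' hka.ne
  rw [sign_pos hmu, sign_neg hka] at hs
  exact absurd hs (by decide)

end IsProfile

end Geometry

lemma exists_axis_equator {n : ℕ} (hn : 1 ≤ n) : ∃ e p : Sph n, ⟪(e : Euc n), p⟫_ℝ = 0 := by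
  refine ⟨⟨EuclideanSpace.single 0 1, by simp⟩, ⟨EuclideanSpace.single (Fin.last n) 1, by simp⟩, ?_⟩
  have h : (0 : Fin (n + 1)) ≠ Fin.last n := by
    intro h
    have := congrArg Fin.val h
    simp at this
    omega
  simp [EuclideanSpace.inner_single_left, h]

/-! ### Weighted averages along segments ending at `1` -/

/-- The weighted average `∫₀¹ φ(v) g(1 - (1 - b) v) dv` of `g` along the segment from `1` to `b`. -/
def segAvg (φ g : ℝ → ℝ) (b : ℝ) : ℝ := ∫ v in (0 : ℝ)..1, φ v * g (1 - (1 - b) * v)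

lemma lt_segment {l b v : ℝ} (hl : l < 1) (hb : l < b) (hv : v ∈ Set.Icc (0 : ℝ) 1) :
    l < 1 - (1 - b) * v := by
  rcases hv.1.eq_or_lt with h | h
  · rw [← h]; linarith
  · nlinarith [hv.2]

lemma hasDerivAt_segAvg {φ g : ℝ → ℝ} {l b : ℝ} (hl : l < 1) (hφ : Continuous φ)
    (hg : ContDiffOn ℝ 1 g (Set.Ioi l)) (hb : l < b) :
    HasDerivAt (segAvg φ g) (segAvg (fun v => φ v * v) (deriv g) b) b := by
  have hgd : ∀ x ∈ Set.Ioi l, HasDerivAt g (deriv g x) x := fun x hx =>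
    ((hg.differentiableOn one_ne_zero).differentiableAt (Ioi_mem_nhds hx)).hasDerivAt
  have hgc : ContinuousOn (deriv g) (Set.Ioi l) :=
    hg.continuousOn_deriv_of_isOpen isOpen_Ioi le_rfl
  have hlb : (l + b) / 2 ∈ Set.Ioi l := by simp only [Set.mem_Ioi]; linarith
  have hcont : ∀ k : ℝ → ℝ, ∀ ψ : ℝ → ℝ, Continuous ψ → ContinuousOn k (Set.Ioi l) → ∀ x, l < x →
      ContinuousOn (fun v => ψ v * k (1 - (1 - x) * v)) (Set.Icc 0 1) := fun k ψ hψ hk x hx =>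
    hψ.continuousOn.mul (hk.comp (by fun_prop) fun v hv => lt_segment hl hx hv)
  have hK : ContinuousOn (fun z : ℝ × ℝ => φ z.2 * z.2 * deriv g (1 - (1 - z.1) * z.2))
      (Set.Icc ((l + b) / 2) (b + 1) ×ˢ Set.Icc 0 1) :=
    ContinuousOn.mul (by fun_prop) (hgc.comp (by fun_prop) fun z hz =>
      lt_segment hl (lt_of_lt_of_le hlb hz.1.1) hz.2)
  obtain ⟨C, hC⟩ := (isCompact_Icc.prod isCompact_Icc).exists_bound_of_continuousOn hK
  have hu : Set.uIoc (0 : ℝ) 1 ⊆ Set.Icc 0 1 := by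
    rw [Set.uIoc_of_le zero_le_one]; exact Set.Ioc_subset_Icc_self
  have hmeas : ∀ k : ℝ → ℝ, ContinuousOn k (Set.Icc 0 1) → MeasureTheory.AEStronglyMeasurable k
      (MeasureTheory.volume.restrict (Set.uIoc 0 1)) := fun k hk =>
    (hk.mono hu).aestronglyMeasurable measurableSet_uIoc
  refine (intervalIntegral.hasDerivAt_integral_of_dominated_loc_of_deriv_le
    (F := fun x v => φ v * g (1 - (1 - x) * v))
    (F' := fun x v => φ v * v * deriv g (1 - (1 - x) * v)) (bound := fun _ => C)
    (s := Set.Icc ((l + b) / 2) (b + 1)) (Icc_mem_nhds (by linarith) (by linarith)) ?_ ?_ ?_ ?_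
    intervalIntegrable_const ?_).2
  · filter_upwards [Ioi_mem_nhds hb] with x hx
    exact hmeas _ (hcont g φ hφ hg.continuousOn x hx)
  · refine ContinuousOn.intervalIntegrable ?_
    rw [Set.uIcc_of_le zero_le_one]
    exact hcont g φ hφ hg.continuousOn b hb
  · exact hmeas _ (hcont (deriv g) (fun v => φ v * v) (by fun_prop) hgc b hb)
  · exact Filter.Eventually.of_forall fun v hv x hx => hC (x, v) ⟨hx, hu hv⟩
  · refine Filter.Eventually.of_forall fun v hv x hx => ?_
    have h1 : HasDerivAt (fun x => 1 - (1 - x) * v) v x := by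
      have := (((hasDerivAt_id x).const_sub 1).mul_const v).const_sub 1
      simpa using this
    have h2 := ((hgd _ (lt_segment hl (lt_of_lt_of_le hlb hx.1) (hu hv))).comp x h1).const_mul (φ v)
    convert! h2 using 1
    ring

lemma contDiffOn_segAvg {φ g : ℝ → ℝ} {l : ℝ} (hl : l < 1) (hφ : Continuous φ)
    (hg : ContDiffOn ℝ ∞ g (Set.Ioi l)) : ContDiffOn ℝ ∞ (segAvg φ g) (Set.Ioi l) := by
  have hd : ∀ φ g : ℝ → ℝ, Continuous φ → ContDiffOn ℝ ∞ g (Set.Ioi l) → ∀ b ∈ Set.Ioi l,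
      HasDerivAt (segAvg φ g) (segAvg (fun v => φ v * v) (deriv g) b) b := fun φ g hφ hg b hb =>
    hasDerivAt_segAvg hl hφ (hg.of_le (by exact_mod_cast le_top)) hb
  have hk : ∀ k : ℕ, ∀ φ g : ℝ → ℝ, Continuous φ → ContDiffOn ℝ ∞ g (Set.Ioi l) →
      ContDiffOn ℝ k (segAvg φ g) (Set.Ioi l) := by
    intro k
    induction k with
    | zero =>
      intro φ g hφ hg
      exact contDiffOn_zero.2 fun b hb => (hd φ g hφ hg b hb).continuousAt.continuousWithinAt
    | succ k ih =>
      intro φ g hφ hg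
      push_cast
      rw [contDiffOn_succ_iff_deriv_of_isOpen isOpen_Ioi]
      refine ⟨fun b hb => (hd φ g hφ hg b hb).differentiableAt.differentiableWithinAt,
        by simp, ?_⟩
      exact (ih (fun v => φ v * v) (deriv g) (by fun_prop)
        ((contDiffOn_infty_iff_deriv_of_isOpen isOpen_Ioi).1 hg).2).congr
        fun b hb => (hd φ g hφ hg b hb).deriv
  exact contDiffOn_infty.2 fun k => hk k φ g hφ hg

lemma segAvg_pos {φ g : ℝ → ℝ} {l b : ℝ} (hl : l < 1) (hφ : Continuous φ)
    (hφ0 : ∀ v, 0 < v → 0 < φ v)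
    (hg : ContinuousOn g (Set.Ioi l)) (hg0 : ∀ β, l < β → 0 < g β) (hb : l < b) :
    0 < segAvg φ g b := by
  refine intervalIntegral.intervalIntegral_pos_of_pos_on ?_ (fun v hv => mul_pos (hφ0 v hv.1)
    (hg0 _ (lt_segment hl hb (Set.Ioo_subset_Icc_self hv)))) zero_lt_one
  refine ContinuousOn.intervalIntegrable ?_
  rw [Set.uIcc_of_le zero_le_one]
  exact hφ.continuousOn.mul (hg.comp (by fun_prop) fun v hv => lt_segment hl hb hv)

/-- For the weight `vᵐ⁻¹`, integration by parts turns the derivative of the weighted average into an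
algebraic expression. -/
lemma one_sub_mul_deriv_segAvg {g : ℝ → ℝ} {l b m : ℝ} (hl : l < 1) (hm : 1 ≤ m)
    (hg : ContDiffOn ℝ 1 g (Set.Ioi l)) (hb : l < b) :
    (1 - b) * deriv (segAvg (fun v => v ^ (m - 1)) g) b =
      m * segAvg (fun v => v ^ (m - 1)) g b - g b := by
  have hφ : Continuous fun v : ℝ => v ^ (m - 1) := Real.continuous_rpow_const (by linarith)
  have hφ' : Continuous fun v : ℝ => v ^ m := Real.continuous_rpow_const (by linarith)
  have hgc : ContinuousOn (deriv g) (Set.Ioi l) :=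
    hg.continuousOn_deriv_of_isOpen isOpen_Ioi le_rfl
  have hsub : ∀ v ∈ Set.Icc (0 : ℝ) 1, 1 - (1 - b) * v ∈ Set.Ioi l :=
    fun v hv => lt_segment hl hb hv
  have hi1 : IntervalIntegrable (fun v => v ^ (m - 1) * g (1 - (1 - b) * v))
      MeasureTheory.volume 0 1 := by
    refine ContinuousOn.intervalIntegrable ?_
    rw [Set.uIcc_of_le zero_le_one]
    exact hφ.continuousOn.mul (hg.continuousOn.comp (by fun_prop) hsub)
  have hi2 : IntervalIntegrable (fun v => v ^ (m - 1) * v * deriv g (1 - (1 - b) * v))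
      MeasureTheory.volume 0 1 := by
    refine ContinuousOn.intervalIntegrable ?_
    rw [Set.uIcc_of_le zero_le_one]
    exact (hφ.mul continuous_id).continuousOn.mul (hgc.comp (by fun_prop) hsub)
  have hFTC := intervalIntegral.integral_eq_sub_of_hasDerivAt_of_le zero_le_one
    (f := fun v => v ^ m * g (1 - (1 - b) * v))
    (f' := fun v => m * (v ^ (m - 1) * g (1 - (1 - b) * v)) -
      (1 - b) * (v ^ (m - 1) * v * deriv g (1 - (1 - b) * v)))
    (hφ'.continuousOn.mul (hg.continuousOn.comp (by fun_prop) hsub))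
    (fun v hv => by
      have h1 : HasDerivAt (fun v => 1 - (1 - b) * v) (-(1 - b)) v := by
        have := ((hasDerivAt_id v).const_mul (1 - b)).const_sub 1
        simpa using this
      have h2 := ((hg.differentiableOn one_ne_zero).differentiableAt
        (Ioi_mem_nhds (hsub v (Set.Ioo_subset_Icc_self hv)))).hasDerivAt.comp v h1
      have h3 := (Real.hasDerivAt_rpow_const (Or.inr hm) (x := v)).mul h2
      have h4 : v ^ (m - 1) * v = v ^ m := by
        rw [← Real.rpow_add_one hv.1.ne', sub_add_cancel]
      convert! h3 using 1
      rw [h4, Function.comp_apply]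
      ring)
    ((hi1.const_mul m).sub (hi2.const_mul (1 - b)))
  rw [intervalIntegral.integral_sub (hi1.const_mul m) (hi2.const_mul (1 - b)),
    intervalIntegral.integral_const_mul, intervalIntegral.integral_const_mul] at hFTC
  rw [(hasDerivAt_segAvg hl hφ hg hb).deriv]
  simp only [segAvg]
  simp only [mul_one, mul_zero, sub_sub_cancel, Real.one_rpow, one_mul,
    Real.zero_rpow (by linarith : m ≠ 0), zero_mul, sub_zero] at hFTC
  linarith

/-! ### The first integral of the curvature equation -/

/-- The integrand `(1 + β)^(n/2 - 1) / β^(r - 1)` of the first integral of the curvature equation,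
as a function of the cosine `β` of the distance to the axis. -/
def density (n r : ℕ) (β : ℝ) : ℝ := (1 + β) ^ ((n : ℝ) / 2 - 1) / β ^ (r - 1)

/-- The function `J` with `∫_b^1 (1 - β²)^(n/2 - 1) β^(1 - r) dβ = (1 - b)^(n/2) J(b)`. Unlike the
integral itself, it is smooth at `b = 1` for every `n`. -/
def densityAvg (n r : ℕ) : ℝ → ℝ := segAvg (fun v => v ^ ((n : ℝ) / 2 - 1)) (density n r)

/-- The ratio `sin s / sin θ` of the solution of the curvature equation, as a function of
`b = cos s`: the positive function `A` with `Aʳ = (1 + b)^(n/2) / (c J(b))`. -/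
def sineRatio (n r : ℕ) (c b : ℝ) : ℝ :=
  Real.exp (((n : ℝ) / 2 * Real.log (1 + b) - Real.log (c * densityAvg n r b)) / r)

/-- The value of `sin² θ` of the solution of the curvature equation, as a function of
`b = cos s`. -/
def sineSq (n r : ℕ) (c b : ℝ) : ℝ := (1 - b ^ 2) / sineRatio n r c b ^ 2

/-- `l` is an admissible lower bound for the cosine of the distance to the axis: the density is
smooth and positive on `(l, ∞)`. -/
structure IsAdmissible (n r : ℕ) (l : ℝ) : Prop where
  two_le : 2 ≤ n
  one_le : 1 ≤ r
  le : r ≤ n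
  neg_one_le : -1 ≤ l
  lt_one : l < 1
  pow_pred_pos : ∀ β, l < β → 0 < β ^ (r - 1)

lemma sineRatio_pos (n r : ℕ) (c b : ℝ) : 0 < sineRatio n r c b := Real.exp_pos _

namespace IsAdmissible

variable {n r : ℕ} {l c : ℝ} (hl : IsAdmissible n r l)
include hl

lemma density_pos {β : ℝ} (hβ : l < β) : 0 < density n r β :=
  div_pos (Real.rpow_pos_of_pos (by linarith [hl.neg_one_le]) _) (hl.pow_pred_pos β hβ)

lemma contDiffOn_density : ContDiffOn ℝ ∞ (density n r) (Set.Ioi l) := by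
  refine ContDiffOn.div ?_ (contDiff_id.pow _).contDiffOn fun β hβ => (hl.pow_pred_pos β hβ).ne'
  refine ContDiffOn.rpow_const_of_ne (by fun_prop) fun β hβ => ?_
  have : l < β := hβ
  linarith [hl.neg_one_le]

lemma exponent_nonneg : 0 ≤ (n : ℝ) / 2 - 1 := by
  have : (2 : ℝ) ≤ n := by exact_mod_cast hl.two_le
  linarith

lemma r_pos : (0 : ℝ) < r := by exact_mod_cast hl.one_le

lemma continuous_weight : Continuous fun v : ℝ => v ^ ((n : ℝ) / 2 - 1) :=
  Real.continuous_rpow_const hl.exponent_nonneg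

lemma densityAvg_pos {b : ℝ} (hb : l < b) : 0 < densityAvg n r b :=
  segAvg_pos hl.lt_one hl.continuous_weight (fun _ hv => Real.rpow_pos_of_pos hv _)
    hl.contDiffOn_density.continuousOn (fun _ hβ => hl.density_pos hβ) hb

lemma contDiffOn_densityAvg : ContDiffOn ℝ ∞ (densityAvg n r) (Set.Ioi l) :=
  contDiffOn_segAvg hl.lt_one hl.continuous_weight hl.contDiffOn_density

lemma one_sub_mul_deriv_densityAvg {b : ℝ} (hb : l < b) :
    (1 - b) * deriv (densityAvg n r) b = (n : ℝ) / 2 * densityAvg n r b - density n r b :=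
  one_sub_mul_deriv_segAvg hl.lt_one (by linarith [hl.exponent_nonneg])
    (hl.contDiffOn_density.of_le (by exact_mod_cast le_top)) hb

lemma contDiffOn_sineRatio (hc : 0 < c) : ContDiffOn ℝ ∞ (sineRatio n r c) (Set.Ioi l) := by
  refine ContDiffOn.exp (ContDiffOn.div_const (ContDiffOn.sub (contDiffOn_const.mul
    (ContDiffOn.log (by fun_prop) fun b hb => ?_)) (ContDiffOn.log (contDiffOn_const.mul
    hl.contDiffOn_densityAvg) fun b hb => (mul_pos hc (hl.densityAvg_pos hb)).ne')) _)
  have : l < b := hb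
  linarith [hl.neg_one_le]

lemma contDiffOn_sineSq (hc : 0 < c) : ContDiffOn ℝ ∞ (sineSq n r c) (Set.Ioi l) :=
  ContDiffOn.div (by fun_prop) ((hl.contDiffOn_sineRatio hc).pow 2) fun b _ =>
    (pow_pos (sineRatio_pos n r c b) 2).ne'

lemma one_add_pos {b : ℝ} (hb : l < b) : 0 < 1 + b := by linarith [hl.neg_one_le]

lemma sineRatio_pow (hc : 0 < c) {b : ℝ} (hb : l < b) :
    sineRatio n r c b ^ r = (1 + b) ^ ((n : ℝ) / 2) / (c * densityAvg n r b) := by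
  rw [sineRatio, ← Real.exp_nat_mul, mul_div_cancel₀ _ hl.r_pos.ne', Real.exp_sub,
    Real.exp_log (mul_pos hc (hl.densityAvg_pos hb)), Real.rpow_def_of_pos (hl.one_add_pos hb),
    mul_comm]

lemma one_sub_mul_deriv_sineRatio (hc : 0 < c) {b : ℝ} (hb : l < b) :
    r * (1 - b) * deriv (sineRatio n r c) b =
      sineRatio n r c b * (density n r b / densityAvg n r b - n * b / (1 + b)) := by
  have hJ := hl.densityAvg_pos hb
  have h1b := hl.one_add_pos hb
  have hr := hl.r_pos
  have hd := ((hl.contDiffOn_densityAvg.differentiableOn (by simp)).differentiableAt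
    (Ioi_mem_nhds hb)).hasDerivAt
  have h := ((((((hasDerivAt_id b).const_add 1).log h1b.ne').const_mul ((n : ℝ) / 2)).sub
    ((hd.const_mul c).log (mul_pos hc hJ).ne')).div_const (r : ℝ)).exp
  have h' : HasDerivAt (sineRatio n r c) _ b := h
  rw [h'.deriv]
  have hode := hl.one_sub_mul_deriv_densityAvg hb
  change _ * (1 - b) * (sineRatio n r c b * _) = _
  simp only [id]
  field_simp
  linear_combination (-2 * (1 + b) * sineRatio n r c b) * hode

lemma deriv_sineSq (hc : 0 < c) {b : ℝ} (hb : l < b) :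
    deriv (sineSq n r c) b = 2 / (r * sineRatio n r c b ^ 2) *
      ((n - r) * b - (1 + b) * density n r b / densityAvg n r b) := by
  have hJ := hl.densityAvg_pos hb
  have h1b := hl.one_add_pos hb
  have hr := hl.r_pos
  have hA := sineRatio_pos n r c b
  have hd := (((hl.contDiffOn_sineRatio hc).differentiableOn (by simp)).differentiableAt
    (Ioi_mem_nhds hb)).hasDerivAt
  have h := (((hasDerivAt_id b).pow 2).const_sub 1).div (hd.pow 2) (pow_pos hA 2).ne'
  have h' : HasDerivAt (sineSq n r c) _ b := h
  rw [h'.deriv]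
  have hA' := hl.one_sub_mul_deriv_sineRatio hc hb
  simp only [id, Pi.pow_apply]
  field_simp at hA' ⊢

  linear_combination (-2 * sineRatio n r c b) * hA'

end IsAdmissible

/-- The integral that bounds `densityAvg`: with `β = 1 - (1 - b) v`, the integrand is a multiple of
the derivative of `(v (1 + β))ᵐ`. -/
lemma integral_rpow_mul_rpow_segment {m : ℝ} (hm : 1 ≤ m) {b : ℝ} (hb : -1 < b) :
    ∫ v in (0 : ℝ)..1, v ^ (m - 1) * ((1 + (1 - (1 - b) * v)) ^ (m - 1) * (1 - (1 - b) * v)) =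
      (1 + b) ^ m / (2 * m) := by
  have hpos : ∀ v ∈ Set.Icc (0 : ℝ) 1, 0 ≤ 1 + (1 - (1 - b) * v) := fun v hv => by
    have := lt_segment (by norm_num : (-1 : ℝ) < 1) hb hv
    linarith
  have hcont : Continuous fun v : ℝ => (v * (1 + (1 - (1 - b) * v))) ^ (m - 1) *
      (1 - (1 - b) * v) := by
    refine Continuous.mul ?_ (by fun_prop)
    exact (Real.continuous_rpow_const (by linarith : 0 ≤ m - 1)).comp (by fun_prop)
  have hd : ∀ v ∈ Set.uIcc (0 : ℝ) 1, HasDerivAt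
      (fun v => (v * (1 + (1 - (1 - b) * v))) ^ m / (2 * m))
      ((v * (1 + (1 - (1 - b) * v))) ^ (m - 1) * (1 - (1 - b) * v)) v := fun v _ => by
    have h1 : HasDerivAt (fun v => v * (1 + (1 - (1 - b) * v))) (2 * (1 - (1 - b) * v)) v := by
      have := (hasDerivAt_id v).mul
        ((((hasDerivAt_id v).const_mul (1 - b)).const_sub 1).const_add 1)
      convert! this using 1
      simp only [id]
      ring
    convert! (h1.rpow_const (p := m) (Or.inr hm)).div_const (2 * m) using 1
    field_simp
  have h := intervalIntegral.integral_eq_sub_of_hasDerivAt hd (hcont.intervalIntegrable _ _)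
  rw [zero_mul, Real.zero_rpow (by linarith), zero_div, sub_zero] at h
  simp only [mul_one, one_mul, sub_sub_cancel] at h
  rw [← h]
  refine intervalIntegral.integral_congr fun v hv => ?_
  rw [Set.uIcc_of_le zero_le_one] at hv
  rw [Real.mul_rpow hv.1 (hpos v hv), mul_assoc]

namespace IsAdmissible

variable {n r : ℕ} {l c : ℝ} (hl : IsAdmissible n r l)
include hl

lemma density_mul_pow {b : ℝ} (hb : l < b) :
    density n r b * b ^ (r - 1) = (1 + b) ^ ((n : ℝ) / 2 - 1) :=
  div_mul_cancel₀ _ (hl.pow_pred_pos b hb).ne'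

lemma one_add_mul_density {b : ℝ} (hb : l < b) :
    (1 + b) * density n r b * b ^ (r - 1) = (1 + b) ^ ((n : ℝ) / 2) := by
  rw [mul_assoc, hl.density_mul_pow hb, mul_comm, ← Real.rpow_add_one (hl.one_add_pos hb).ne',
    sub_add_cancel]

lemma intervalIntegrable_density {b : ℝ} (hb : l < b) :
    IntervalIntegrable (fun v => v ^ ((n : ℝ) / 2 - 1) * density n r (1 - (1 - b) * v))
      MeasureTheory.volume 0 1 := by
  refine ContinuousOn.intervalIntegrable ?_
  rw [Set.uIcc_of_le zero_le_one]
  exact hl.continuous_weight.continuousOn.mul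
    (hl.contDiffOn_density.continuousOn.comp (by fun_prop) fun v hv => lt_segment hl.lt_one hb hv)

/-- The bound `cos s ∫₀ˢ sinⁿ⁻¹ / cosʳ⁻¹ ≤ sinⁿ s / (n cosʳ⁻¹ s)`, for the cosine `b` of `s`. -/
lemma mul_densityAvg_le {b : ℝ} (hb : l < b) (hb0 : 0 < b) (hb1 : b ≤ 1) :
    n * (b * densityAvg n r b) ≤ (1 + b) * density n r b := by
  have hn : (2 : ℝ) ≤ n := by exact_mod_cast hl.two_le
  have hpow : 0 < b ^ (r - 1) := pow_pos hb0 _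
  have h1 : b * densityAvg n r b ≤ ∫ v in (0 : ℝ)..1, (b ^ (r - 1))⁻¹ * (v ^ ((n : ℝ) / 2 - 1) *
      ((1 + (1 - (1 - b) * v)) ^ ((n : ℝ) / 2 - 1) * (1 - (1 - b) * v))) := by
    rw [densityAvg, segAvg, ← intervalIntegral.integral_const_mul]
    refine intervalIntegral.integral_mono_on zero_le_one
      ((hl.intervalIntegrable_density hb).const_mul b) ?_ fun v hv => ?_
    · refine Continuous.intervalIntegrable ?_ _ _
      refine continuous_const.mul (hl.continuous_weight.mul (Continuous.mul ?_ (by fun_prop)))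
      exact (Real.continuous_rpow_const hl.exponent_nonneg).comp (by fun_prop)
    · have hβ : b ≤ 1 - (1 - b) * v := by nlinarith [hv.2]
      set β := 1 - (1 - b) * v
      have hβ0 : 0 < β := hb0.trans_le hβ
      have hv0 : 0 ≤ v ^ ((n : ℝ) / 2 - 1) := Real.rpow_nonneg hv.1 _
      have hβ1 : 0 ≤ (1 + β) ^ ((n : ℝ) / 2 - 1) := Real.rpow_nonneg (by linarith) _
      have hkey : b / β ^ (r - 1) ≤ β / b ^ (r - 1) := by
        rw [div_le_div_iff₀ (pow_pos hβ0 _) hpow]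
        exact mul_le_mul hβ (pow_le_pow_left₀ hb0.le hβ _) hpow.le hβ0.le
      calc b * (v ^ ((n : ℝ) / 2 - 1) * density n r β)
          = v ^ ((n : ℝ) / 2 - 1) * (1 + β) ^ ((n : ℝ) / 2 - 1) * (b / β ^ (r - 1)) := by
            rw [density]; ring
        _ ≤ v ^ ((n : ℝ) / 2 - 1) * (1 + β) ^ ((n : ℝ) / 2 - 1) * (β / b ^ (r - 1)) :=
            mul_le_mul_of_nonneg_left hkey (mul_nonneg hv0 hβ1)
        _ = _ := by ring
  rw [intervalIntegral.integral_const_mul, integral_rpow_mul_rpow_segment (by linarith)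
    (by linarith), mul_div_cancel₀ _ two_ne_zero, ← hl.one_add_mul_density hb] at h1
  calc n * (b * densityAvg n r b)
      ≤ n * ((b ^ (r - 1))⁻¹ * ((1 + b) * density n r b * b ^ (r - 1) / n)) :=
        mul_le_mul_of_nonneg_left h1 (by linarith)
    _ = _ := by field_simp

lemma deriv_sineSq_neg (hc : 0 < c) {b : ℝ} (hb : l < b) (hb1 : b ≤ 1) :
    deriv (sineSq n r c) b < 0 := by
  have hJ := hl.densityAvg_pos hb
  have hg := hl.density_pos hb
  have h1b := hl.one_add_pos hb
  have hr := hl.r_pos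
  have hA := sineRatio_pos n r c b
  have hrn : (r : ℝ) ≤ n := by exact_mod_cast hl.le
  have hpos : 0 < (1 + b) * density n r b := mul_pos h1b hg
  rw [hl.deriv_sineSq hc hb]
  refine mul_neg_of_pos_of_neg (by positivity) ?_
  rw [sub_neg, lt_div_iff₀ hJ]
  rcases le_or_gt b 0 with hb0 | hb0
  · exact lt_of_le_of_lt (mul_nonpos_of_nonpos_of_nonneg
      (mul_nonpos_of_nonneg_of_nonpos (by linarith) hb0) hJ.le) hpos
  · have h := hl.mul_densityAvg_le hb hb0 hb1
    nlinarith [mul_pos hr (mul_pos hb0 hJ)]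

/-- The curvature equation, in terms of the curvature `b / A` of the parallels and of the curvature
`-A W' / 2` of the meridians, where `A` is `sineRatio` and `W` is `sineSq`. -/
lemma curvature_eq {H : ℝ} (hH : 0 < H) {b : ℝ} (hb : l < b)
    (hc : c = r * H / ((n - 1).choose (r - 1))) :
    ((n - 1).choose r : ℝ) * (b / sineRatio n r c b) ^ r +
      ((n - 1).choose (r - 1) : ℝ) * (b / sineRatio n r c b) ^ (r - 1) *
        (-(sineRatio n r c b) * deriv (sineSq n r c) b / 2) = H := by
  have hr := hl.r_pos
  have hchoose : 0 < ((n - 1).choose (r - 1) : ℝ) := by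
    exact_mod_cast Nat.choose_pos (Nat.sub_le_sub_right hl.le 1)
  have hc0 : 0 < c := by rw [hc]; positivity
  have hJ := hl.densityAvg_pos hb
  have hA := sineRatio_pos n r c b
  have hC : ((n - 1).choose r : ℝ) * r = (n - 1).choose (r - 1) * (n - r) := by
    have h := Nat.choose_succ_right_eq (n - 1) (r - 1)
    rw [Nat.sub_add_cancel hl.one_le] at h
    have h2 : n - 1 - (r - 1) = n - r := by have := hl.one_le; omega
    rw [h2] at h
    rw [← Nat.cast_sub hl.le]
    exact_mod_cast h
  have hApow := hl.sineRatio_pow hc0 hb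
  have hg := hl.one_add_mul_density hb
  rw [← hg] at hApow
  rw [hl.deriv_sineSq hc0 hb]
  have hk : r = r - 1 + 1 := (Nat.sub_add_cancel hl.one_le).symm
  generalize r - 1 = k at *
  have hAr : sineRatio n r c b ^ r = sineRatio n r c b ^ k * sineRatio n r c b := by
    rw [← pow_succ, ← hk]
  have hbr : (b / sineRatio n r c b) ^ r =
      (b / sineRatio n r c b) ^ k * (b / sineRatio n r c b) := by
    rw [← pow_succ, ← hk]
  rw [hAr] at hApow
  rw [hbr, div_pow]
  generalize sineRatio n r c b = A at *
  generalize densityAvg n r b = J at *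
  generalize density n r b = g at *
  have hcC : c * (n - 1).choose k = r * H := by rw [hc]; field_simp
  have hApow' : A ^ k * A * (c * J) = (1 + b) * g * b ^ k := by
    rw [hApow]; field_simp
  calc _ = b ^ k / (A ^ k * A * r) * (b * ((n - 1).choose r * r - (n - 1).choose k * (n - r)) +
        (n - 1).choose k * ((1 + b) * g / J)) := by field_simp; ring
    _ = (n - 1).choose k * ((1 + b) * g * b ^ k) / (A ^ k * A * r * J) := by
      rw [hC]; field_simp; ring
    _ = c * (n - 1).choose k / r := by rw [← hApow']; field_simp
    _ = H := by rw [hcC]; field_simp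

end IsAdmissible

/-! ### The equator of the solution -/

/-- The lower bound for the cosine of the distance to the axis: the solution of the curvature
equation lives on the whole sphere for the mean curvature, and on a hemisphere otherwise. -/
def cosLower (r : ℕ) : ℝ := if r = 1 then -1 else 0

lemma isAdmissible_cosLower {n r : ℕ} (hn : 2 ≤ n) (hr : 1 ≤ r) (hrn : r ≤ n) :
    IsAdmissible n r (cosLower r) := by
  by_cases h : r = 1
  · subst h
    exact ⟨hn, hr, hrn, by simp [cosLower], by simp [cosLower], by simp⟩
  · refine ⟨hn, hr, hrn, by simp [cosLower, h], by simp [cosLower, h], fun β hβ => ?_⟩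
    rw [cosLower, if_neg h] at hβ
    exact pow_pos hβ _

/-- For `r > 1`, the density is not integrable at the equator: its average has a logarithmic lower
bound. -/
lemma neg_log_sub_le_densityAvg {n r : ℕ} (hl : IsAdmissible n r 0) (hr : 1 < r) {b : ℝ}
    (hb : 0 < b) (hb1 : b < 1) : -Real.log b - n ≤ densityAvg n r b := by
  have hd : ∀ v ∈ Set.uIcc (0 : ℝ) 1, HasDerivAt
      (fun v => -Real.log (1 - (1 - b) * v) / (1 - b) - n * v) (1 / (1 - (1 - b) * v) - n) v := by
    intro v hv
    rw [Set.uIcc_of_le zero_le_one] at hv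
    have h0 := (lt_segment zero_lt_one hb hv).ne'
    have h1b : 1 - b ≠ 0 := by linarith
    have h := ((((((hasDerivAt_id v).const_mul (1 - b)).const_sub 1).log h0).neg.div_const
      (1 - b)).sub ((hasDerivAt_id v).const_mul (n : ℝ)))
    convert! h using 1
    simp only [id]
    field_simp
  have hint : IntervalIntegrable (fun v : ℝ => 1 / (1 - (1 - b) * v) - n)
      MeasureTheory.volume 0 1 := by
    refine ContinuousOn.intervalIntegrable ?_
    rw [Set.uIcc_of_le zero_le_one]
    exact (ContinuousOn.div (by fun_prop) (by fun_prop)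
      fun v hv => (lt_segment zero_lt_one hb hv).ne').sub continuousOn_const
  have hFTC := intervalIntegral.integral_eq_sub_of_hasDerivAt hd hint
  have hlog : Real.log b < 0 := Real.log_neg hb hb1
  have h1 : -Real.log b - n ≤ ∫ v in (0 : ℝ)..1, (1 / (1 - (1 - b) * v) - n) := by
    rw [hFTC]
    simp only [mul_one, sub_sub_cancel, mul_zero, sub_zero, Real.log_one, neg_zero, zero_div]
    have : -Real.log b ≤ -Real.log b / (1 - b) := by
      rw [le_div_iff₀ (by linarith)]
      nlinarith
    linarith
  refine h1.trans (intervalIntegral.integral_mono_on zero_le_one hint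
    (hl.intervalIntegrable_density hb) fun v hv => ?_)
  have hβ0 := lt_segment zero_lt_one hb hv
  have hβ1 : 1 - (1 - b) * v ≤ 1 := by nlinarith [hv.1]
  have hβv : 1 - v ≤ 1 - (1 - b) * v := by nlinarith [hv.1]
  simp only
  set β := 1 - (1 - b) * v
  have hn0 := hl.exponent_nonneg
  -- Bernoulli's inequality bounds the weight below by an affine function of `v`.
  have hweight : 1 - n * (1 - v) ≤ v ^ ((n : ℝ) / 2 - 1) := by
    have h2 : 1 + (n : ℝ) * (v - 1) ≤ (1 + (v - 1)) ^ n :=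
      one_add_mul_le_pow (by linarith [hv.1]) n
    rw [add_sub_cancel] at h2
    have h3 : v ^ n ≤ v ^ ((n : ℝ) / 2 - 1) := by
      rcases hv.1.eq_or_lt with h | h
      · rw [← h, zero_pow (by have := hl.two_le; omega)]
        exact Real.rpow_nonneg le_rfl _
      · rw [← Real.rpow_natCast]
        exact Real.rpow_le_rpow_of_exponent_ge h hv.2 (by linarith)
    linarith
  have hdens : 1 / β ≤ density n r β := by
    rw [density, div_le_div_iff₀ hβ0 (pow_pos hβ0 _), one_mul]
    have h2 : β ^ (r - 1) ≤ β := pow_le_of_le_one hβ0.le hβ1 (by omega)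
    have h3 : 1 ≤ (1 + β) ^ ((n : ℝ) / 2 - 1) := Real.one_le_rpow (by linarith) hn0
    nlinarith
  have hv0 : 0 ≤ v ^ ((n : ℝ) / 2 - 1) := Real.rpow_nonneg hv.1 _
  calc 1 / β - n ≤ (1 - n * (1 - v)) * (1 / β) := by
        have : (1 - v) * (1 / β) ≤ 1 := by
          rw [mul_one_div, div_le_one hβ0]; exact hβv
        have hn' : (0 : ℝ) ≤ n := Nat.cast_nonneg n
        nlinarith
    _ ≤ v ^ ((n : ℝ) / 2 - 1) * (1 / β) := mul_le_mul_of_nonneg_right hweight (by positivity)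
    _ ≤ _ := mul_le_mul_of_nonneg_left hdens hv0

lemma exists_one_le_sineSq_of_one_lt {n r : ℕ} {c : ℝ} (hl : IsAdmissible n r 0) (hr : 1 < r)
    (hc : 0 < c) : ∃ b ∈ Set.Ioo (0 : ℝ) 1, 1 ≤ sineSq n r c b := by
  -- `J ≥ M` forces `Aʳ ≤ 2⁻ʳ`, and then `W ≥ (1 - b²) / (1/4) ≥ 1`.
  set M : ℝ := 2 ^ ((n : ℝ) / 2) * 2 ^ r / c with hM
  have hM0 : 0 < M := by positivity
  have hn : (0 : ℝ) ≤ n := Nat.cast_nonneg n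
  set b := Real.exp (-(n + M + 1)) with hb
  have hb0 : 0 < b := Real.exp_pos _
  have hbhalf : b ≤ 1 / 2 := by
    have h1 : b ≤ Real.exp (-1) := Real.exp_le_exp.2 (by linarith)
    have h2 := Real.exp_one_gt_d9
    have h3 : Real.exp (-1) ≤ 1 / 2 := by
      rw [Real.exp_neg, ← one_div, div_le_div_iff₀ (Real.exp_pos 1) two_pos]
      linarith
    linarith
  have hJ := neg_log_sub_le_densityAvg hl hr hb0 (by linarith)
  rw [hb, Real.log_exp, ← hb] at hJ
  refine ⟨b, ⟨hb0, by linarith⟩, ?_⟩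
  have hApow := hl.sineRatio_pow hc hb0
  have hA := sineRatio_pos n r c b
  have hle : sineRatio n r c b ^ r ≤ (1 / 2) ^ r := by
    rw [hApow]
    calc (1 + b) ^ ((n : ℝ) / 2) / (c * densityAvg n r b)
        ≤ 2 ^ ((n : ℝ) / 2) / (c * M) := by
          refine div_le_div₀ (by positivity) (Real.rpow_le_rpow (by linarith) (by linarith)
            (by positivity)) (by positivity) (mul_le_mul_of_nonneg_left (by linarith) hc.le)
      _ = (1 / 2) ^ r := by
        rw [hM, one_div_pow]
        have : (2 : ℝ) ^ ((n : ℝ) / 2) ≠ 0 := by positivity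
        field_simp
  have hA2 : sineRatio n r c b ≤ 1 / 2 :=
    le_of_pow_le_pow_left₀ (by omega) (by norm_num) hle
  rw [sineSq, one_le_div (pow_pos hA 2)]
  nlinarith

lemma exists_one_le_sineSq_of_eq_one {n : ℕ} {c : ℝ} (hl : IsAdmissible n 1 (-1)) (hc : 0 < c) :
    ∃ b ∈ Set.Ioo (-1 : ℝ) 1, 1 ≤ sineSq n 1 c b := by
  have hn0 := hl.exponent_nonneg
  -- A positive lower bound for the average of the density.
  obtain ⟨J₀, hJ₀, hJ⟩ : ∃ J₀, 0 < J₀ ∧ ∀ b, -1 < b → J₀ ≤ densityAvg n 1 b := by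
    have hcont : Continuous fun v : ℝ => v ^ ((n : ℝ) / 2 - 1) * (2 - 2 * v) ^ ((n : ℝ) / 2 - 1) :=
      hl.continuous_weight.mul (hl.continuous_weight.comp (by fun_prop))
    refine ⟨∫ v in (0 : ℝ)..1, v ^ ((n : ℝ) / 2 - 1) * (2 - 2 * v) ^ ((n : ℝ) / 2 - 1),
      intervalIntegral.intervalIntegral_pos_of_pos_on (hcont.intervalIntegrable _ _)
        (fun v hv => mul_pos (Real.rpow_pos_of_pos hv.1 _) (Real.rpow_pos_of_pos
          (by linarith [hv.2]) _)) zero_lt_one, fun b hb => ?_⟩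
    refine intervalIntegral.integral_mono_on zero_le_one (hcont.intervalIntegrable _ _)
      (hl.intervalIntegrable_density hb) fun v hv => ?_
    simp only [density, Nat.sub_self, pow_zero, div_one]
    refine mul_le_mul_of_nonneg_left (Real.rpow_le_rpow (by linarith [hv.2]) ?_ hn0)
      (Real.rpow_nonneg hv.1 _)
    nlinarith [hv.1]
  -- At distance `ε` from the lower end, `A ≤ ε / (c J₀)`, while `1 - b² ≥ ε`.
  set ε : ℝ := min (1 / 2) ((c * J₀) ^ 2) with hε
  have hε0 : 0 < ε := lt_min (by norm_num) (by positivity)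
  have hε1 : ε ≤ 1 / 2 := min_le_left _ _
  have hε2 : ε ≤ (c * J₀) ^ 2 := min_le_right _ _
  refine ⟨-1 + ε, ⟨by linarith, by linarith⟩, ?_⟩
  have hb : (-1 : ℝ) < -1 + ε := by linarith
  have hApow := hl.sineRatio_pow hc hb
  rw [pow_one, add_neg_cancel_left] at hApow
  have hcJ : c * J₀ ≤ c * densityAvg n 1 (-1 + ε) := mul_le_mul_of_nonneg_left (hJ _ hb) hc.le
  have hcJ0 : 0 < c * J₀ := by positivity
  have hpow : ε ^ ((n : ℝ) / 2) ≤ ε := by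
    have := Real.rpow_le_rpow_of_exponent_ge hε0 (by linarith) (by linarith : (1 : ℝ) ≤ (n : ℝ) / 2)
    rwa [Real.rpow_one] at this
  have hA : sineRatio n 1 c (-1 + ε) ≤ ε / (c * J₀) := by
    rw [hApow]
    exact div_le_div₀ hε0.le hpow hcJ0 hcJ
  have hA0 := sineRatio_pos n 1 c (-1 + ε)
  rw [sineSq, one_le_div (pow_pos hA0 2)]
  calc sineRatio n 1 c (-1 + ε) ^ 2 ≤ (ε / (c * J₀)) ^ 2 := pow_le_pow_left₀ hA0.le hA 2
    _ = ε * (ε / (c * J₀) ^ 2) := by rw [div_pow]; ring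
    _ ≤ ε * 1 := mul_le_mul_of_nonneg_left ((div_le_one (by positivity)).2 hε2) hε0.le
    _ ≤ _ := by nlinarith

lemma exists_sineSq_eq_one {n r : ℕ} {c : ℝ} (hn : 2 ≤ n) (hr : 1 ≤ r) (hrn : r ≤ n)
    (hc : 0 < c) : ∃ b ∈ Set.Ioo (cosLower r) 1, sineSq n r c b = 1 := by
  have hl := isAdmissible_cosLower hn hr hrn
  obtain ⟨b, hb, hW⟩ : ∃ b ∈ Set.Ioo (cosLower r) 1, 1 ≤ sineSq n r c b := by
    by_cases h : r = 1
    · subst h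
      simp only [cosLower, if_true] at hl ⊢
      exact exists_one_le_sineSq_of_eq_one hl hc
    · simp only [cosLower, if_neg h] at hl ⊢
      exact exists_one_le_sineSq_of_one_lt hl (by omega) hc
  have hcont : ContinuousOn (sineSq n r c) (Set.Icc b 1) :=
    (hl.contDiffOn_sineSq hc).continuousOn.mono fun x hx => lt_of_lt_of_le hb.1 hx.1
  have h1 : sineSq n r c 1 = 0 := by simp [sineSq]
  obtain ⟨x, hx, hx1⟩ := intermediate_value_Icc' hb.2.le hcont
    (show (1 : ℝ) ∈ Set.Icc (sineSq n r c 1) (sineSq n r c b) from ⟨by rw [h1]; norm_num, hW⟩)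
  refine ⟨x, ⟨lt_of_lt_of_le hb.1 hx.1, lt_of_le_of_ne hx.2 ?_⟩, hx1⟩
  rintro rfl
  rw [h1] at hx1
  norm_num at hx1

/-- The substitution `v = 1 - cos s`. -/
lemma densityAvg_one_zero {n : ℕ} (hn : 2 ≤ n) : densityAvg n 1 0 = sineIntegral n := by
  have hl := isAdmissible_cosLower hn le_rfl (by omega)
  have hn0 := hl.exponent_nonneg
  have hcont : Continuous fun v : ℝ => v ^ ((n : ℝ) / 2 - 1) * (1 + (1 - v)) ^ ((n : ℝ) / 2 - 1) :=
    hl.continuous_weight.mul (hl.continuous_weight.comp (by fun_prop))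
  have h := intervalIntegral.integral_comp_mul_deriv (a := 0) (b := Real.pi / 2)
    (f := fun s => 1 - Real.cos s) (f' := Real.sin)
    (g := fun v : ℝ => v ^ ((n : ℝ) / 2 - 1) * (1 + (1 - v)) ^ ((n : ℝ) / 2 - 1))
    (fun s _ => by simpa using (Real.hasDerivAt_cos s).const_sub 1)
    Real.continuous_sin.continuousOn hcont
  simp only [Real.cos_zero, sub_self, Real.cos_pi_div_two, sub_zero, Function.comp_def] at h
  have h2 : densityAvg n 1 0 = ∫ v in (0 : ℝ)..1, v ^ ((n : ℝ) / 2 - 1) *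
      (1 + (1 - v)) ^ ((n : ℝ) / 2 - 1) := by
    simp [densityAvg, segAvg, density]
  rw [h2, ← h, sineIntegral]
  refine intervalIntegral.integral_congr fun s hs => ?_
  rw [Set.uIcc_of_le (by positivity)] at hs
  have hs0 : 0 ≤ Real.sin s := Real.sin_nonneg_of_nonneg_of_le_pi hs.1
    (by linarith [hs.2, Real.pi_pos])
  have hcos := Real.cos_le_one s
  have hcos' := Real.neg_one_le_cos s
  have hsq : (1 - Real.cos s) * (1 + (1 - (1 - Real.cos s))) = Real.sin s ^ (2 : ℝ) := by
    rw [Real.rpow_two, Real.sin_sq]; ring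
  have hexp : 2 * ((n : ℝ) / 2 - 1) = ((n - 2 : ℕ) : ℝ) := by
    rw [Nat.cast_sub hn]; push_cast; ring
  rw [← Real.mul_rpow (by linarith) (by linarith), hsq, ← Real.rpow_mul hs0, hexp,
    Real.rpow_natCast, ← pow_succ]
  congr 1
  omega

lemma sineSq_one_zero {n : ℕ} {c : ℝ} (hn : 2 ≤ n) (hc : 0 < c) :
    sineSq n 1 c 0 = (c * sineIntegral n) ^ 2 := by
  have hl := isAdmissible_cosLower hn le_rfl (by omega : 1 ≤ n)
  have h0 : cosLower 1 < 0 := by simp [cosLower]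
  have h := hl.sineRatio_pow hc h0
  rw [pow_one, add_zero, Real.one_rpow, densityAvg_one_zero hn] at h
  rw [sineSq, h, one_div, inv_pow, div_inv_eq_mul]
  ring

/-! ### Smooth inverses and primitives -/

lemma contDiffAt_invFunOn {W : ℝ → ℝ} {D : Set ℝ} (hD : IsOpen D) (hinj : Set.InjOn W D)
    (hW : ContDiffOn ℝ ∞ W D) (hW' : ∀ x ∈ D, deriv W x ≠ 0) {x : ℝ} (hx : x ∈ D) :
    ContDiffAt ℝ ∞ (Function.invFunOn W D) (W x) ∧
      deriv (Function.invFunOn W D) (W x) = (deriv W x)⁻¹ := by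
  have hWx : ContDiffAt ℝ ∞ W x := hW.contDiffAt (hD.mem_nhds hx)
  have hd : HasDerivAt W (deriv W x) x := (hWx.differentiableAt (by simp)).hasDerivAt
  have hs : HasStrictDerivAt W (deriv W x) x := hWx.hasStrictDerivAt' hd (by simp)
  have hmem : ∀ᶠ y in 𝓝 (W x), y ∈ W '' D := by
    rw [← hs.map_nhds_eq (hW' x hx)]
    exact Filter.image_mem_map (hD.mem_nhds hx)
  have hright : ∀ᶠ y in 𝓝 (W x), W (Function.invFunOn W D y) = y :=
    hmem.mono fun y hy => Function.invFunOn_eq hy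
  have hleft : ∀ z ∈ D, Function.invFunOn W D (W z) = z := fun z hz => hinj.leftInvOn_invFunOn hz
  let f' : ℝ ≃L[ℝ] ℝ := ContinuousLinearEquiv.unitsEquivAut ℝ (Units.mk0 (deriv W x) (hW' x hx))
  have hf' : HasFDerivAt W (f' : ℝ →L[ℝ] ℝ) x := hd.hasFDerivAt_equiv (hW' x hx)
  have hstrict : HasStrictFDerivAt W (f' : ℝ →L[ℝ] ℝ) x := hWx.hasStrictFDerivAt' hf' (by simp)
  have hloc : ContDiffAt ℝ ∞ (hWx.localInverse hf' (by simp)) (W x) :=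
    hWx.to_localInverse hf' (by simp)
  have heq : Function.invFunOn W D =ᶠ[𝓝 (W x)] hWx.localInverse hf' (by simp) := by
    have h1 : ∀ᶠ y in 𝓝 (W x), W (hWx.localInverse hf' (by simp) y) = y :=
      hstrict.eventually_right_inverse
    have h2 : ∀ᶠ y in 𝓝 (W x), hWx.localInverse hf' (by simp) y ∈ D := by
      refine hloc.continuousAt.eventually_mem (hD.mem_nhds ?_)
      rw [hWx.localInverse_apply_image hf' (by simp)]
      exact hx
    filter_upwards [h1, h2] with y hy1 hy2
    conv_lhs => rw [← hy1]
    exact hleft _ hy2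
  have hcd := hloc.congr_of_eventuallyEq heq
  refine ⟨hcd, ?_⟩
  refine (HasDerivAt.of_local_left_inverse hcd.continuousAt ?_ (hW' x hx) hright).deriv
  rw [hleft x hx]
  exact hd

/-- A primitive, vanishing at `0`, of a function which is smooth and even near `[-1, 1]`. -/
lemma exists_odd_primitive {k : ℝ → ℝ} {V : Set ℝ} (hV : IsOpen V) (hIV : Set.Icc (-1) 1 ⊆ V)
    (hk : ContDiffOn ℝ ∞ k V) (hev : ∀ x, k (-x) = k x) :
    ∃ T : ℝ → ℝ, (∀ x ∈ Set.Icc (-1 : ℝ) 1, ContDiffAt ℝ ∞ T x) ∧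
      (∀ x ∈ Set.Icc (-1 : ℝ) 1, deriv T x = k x) ∧ ∀ x, T (-x) = - T x := by
  obtain ⟨δ₁, hδ₁, h₁⟩ := Metric.isOpen_iff.1 hV 1 (hIV ⟨by norm_num, le_rfl⟩)
  obtain ⟨δ₂, hδ₂, h₂⟩ := Metric.isOpen_iff.1 hV (-1) (hIV ⟨le_rfl, by norm_num⟩)
  set ρ := 1 + min δ₁ δ₂ with hρ
  have hρ1 : ρ ≤ 1 + δ₁ := by linarith [min_le_left δ₁ δ₂]
  have hρ2 : ρ ≤ 1 + δ₂ := by linarith [min_le_right δ₁ δ₂]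
  have hρ0 : 1 < ρ := by linarith [lt_min hδ₁ hδ₂]
  have hρV : Set.Ioo (-ρ) ρ ⊆ V := by
    intro x hx
    rcases lt_or_ge 1 x with h | h
    · refine h₁ ?_
      rw [Metric.mem_ball, Real.dist_eq, abs_lt]
      constructor <;> linarith [hx.2]
    · rcases lt_or_ge x (-1) with h' | h'
      · refine h₂ ?_
        rw [Metric.mem_ball, Real.dist_eq, abs_lt]
        constructor <;> linarith [hx.1]
      · exact hIV ⟨h', h⟩
  have hT : ∀ x ∈ Set.Ioo (-ρ) ρ, HasDerivAt (fun x => ∫ y in (0 : ℝ)..x, k y) (k x) x := by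
    intro x hx
    have hc : ContinuousOn k (Set.Ioo (-ρ) ρ) := hk.continuousOn.mono hρV
    refine intervalIntegral.integral_hasDerivAt_right ?_
      (hc.stronglyMeasurableAtFilter isOpen_Ioo x hx) (hc.continuousAt (isOpen_Ioo.mem_nhds hx))
    refine (hc.mono ?_).intervalIntegrable
    exact Set.OrdConnected.uIcc_subset Set.ordConnected_Ioo ⟨by linarith, by linarith⟩ hx
  have hsub : Set.Icc (-1 : ℝ) 1 ⊆ Set.Ioo (-ρ) ρ := fun x hx =>
    ⟨by linarith [hx.1], by linarith [hx.2]⟩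
  refine ⟨fun x => ∫ y in (0 : ℝ)..x, k y, fun x hx => ?_, fun x hx => (hT x (hsub hx)).deriv,
    fun x => ?_⟩
  · refine ContDiffOn.contDiffAt (s := Set.Ioo (-ρ) ρ) ?_ (isOpen_Ioo.mem_nhds (hsub hx))
    rw [contDiffOn_infty_iff_deriv_of_isOpen isOpen_Ioo]
    exact ⟨fun y hy => (hT y hy).differentiableAt.differentiableWithinAt,
      (hk.mono hρV).congr fun y hy => (hT y hy).deriv⟩
  · have h := intervalIntegral.integral_comp_neg (a := 0) (b := x) k
    rw [neg_zero] at h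
    simp only
    rw [intervalIntegral.integral_symm, ← h]
    simp only [hev]

/-! ### The profile of constant curvature -/

/-- A profile whose curvatures solve the equation of constant `r`-th mean curvature. For `r = 1`,
the cosine `b 1` of the radius of the equator has the sign of `H S(n) - 1`. -/
lemma exists_profile {n r : ℕ} (hn : 2 ≤ n) (hr : 1 ≤ r) (hrn : r ≤ n) {H : ℝ} (hH : 0 < H) :
    ∃ a b T : ℝ → ℝ, IsProfile a b T ∧
      (∀ w ∈ Set.Icc (0 : ℝ) 1, ((n - 1).choose r : ℝ) * (b w / a w) ^ r +
        ((n - 1).choose (r - 1) : ℝ) * (b w / a w) ^ (r - 1) * (-(a w) / (2 * deriv b w)) = H) ∧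
      (1 < r → 0 < b 1) ∧
      (r = 1 → (0 < b 1 ↔ 1 < H * sineIntegral n) ∧ (b 1 < 0 ↔ H * sineIntegral n < 1)) := by
  have hl := isAdmissible_cosLower hn hr hrn
  set l := cosLower r with hldef
  have hchoose : 0 < ((n - 1).choose (r - 1) : ℝ) := by
    exact_mod_cast Nat.choose_pos (Nat.sub_le_sub_right hrn 1)
  have hr0 := hl.r_pos
  obtain ⟨c, hc⟩ : ∃ c, c = r * H / ((n - 1).choose (r - 1)) := ⟨_, rfl⟩
  have hc0 : 0 < c := by rw [hc]; positivity
  obtain ⟨b₀, hb₀, hWb₀⟩ := exists_sineSq_eq_one hn hr hrn hc0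
  set W := sineSq n r c with hWdef
  set A := sineRatio n r c with hAdef
  have hWs : ContDiffOn ℝ ∞ W (Set.Ioi l) := hl.contDiffOn_sineSq hc0
  have hAs : ContDiffOn ℝ ∞ A (Set.Ioi l) := hl.contDiffOn_sineRatio hc0
  have hW1 : W 1 = 0 := by simp [hWdef, sineSq]
  -- `W` stays strictly decreasing slightly beyond `1`.
  obtain ⟨u, hu, hW'⟩ : ∃ u, 1 < u ∧ ∀ x ∈ Set.Ioo l u, deriv W x < 0 := by
    have hcont : ContinuousAt (deriv W) 1 :=
      ((contDiffOn_infty_iff_deriv_of_isOpen isOpen_Ioi).1 hWs).2.continuousOn.continuousAt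
        (Ioi_mem_nhds hl.lt_one)
    have h1 : ∀ᶠ x in 𝓝 1, deriv W x < 0 :=
      hcont.eventually_lt_const (hl.deriv_sineSq_neg hc0 hl.lt_one le_rfl)
    obtain ⟨δ, hδ, h⟩ := Metric.eventually_nhds_iff.1 h1
    refine ⟨1 + δ, by linarith, fun x hx => ?_⟩
    rcases le_or_gt x 1 with h' | h'
    · exact hl.deriv_sineSq_neg hc0 hx.1 h'
    · refine h ?_
      rw [Real.dist_eq, abs_lt]
      constructor <;> linarith [hx.2]
  set D := Set.Ioo l u with hD
  have hDl : D ⊆ Set.Ioi l := fun x hx => hx.1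
  have hWD : ContDiffOn ℝ ∞ W D := hWs.mono hDl
  have hanti : StrictAntiOn W D := strictAntiOn_of_deriv_neg (convex_Ioo l u) hWD.continuousOn
    fun x hx => hW' x (interior_subset hx)
  have hb₀D : b₀ ∈ D := ⟨hb₀.1, hb₀.2.trans hu⟩
  have hinv := fun x (hx : x ∈ D) =>
    contDiffAt_invFunOn isOpen_Ioo hanti.injOn hWD (fun x hx => (hW' x hx).ne) hx
  set b := Function.invFunOn W D with hbdef
  have hbW : ∀ x ∈ D, b (W x) = x := fun x hx => hanti.injOn.leftInvOn_invFunOn hx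
  have hU : IsOpen (W '' D) := by
    rw [isOpen_iff_mem_nhds]
    rintro _ ⟨x, hx, rfl⟩
    have hWx : ContDiffAt ℝ ∞ W x := hWD.contDiffAt (isOpen_Ioo.mem_nhds hx)
    have hs : HasStrictDerivAt W (deriv W x) x :=
      hWx.hasStrictDerivAt' (hWx.differentiableAt (by simp)).hasDerivAt (by simp)
    rw [← hs.map_nhds_eq (hW' x hx).ne]
    exact Filter.image_mem_map (isOpen_Ioo.mem_nhds hx)
  have hIU : ∀ w ∈ Set.Icc (0 : ℝ) 1, w ∈ W '' D := by
    intro w hw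
    have hsub : Set.Icc b₀ 1 ⊆ D := fun x hx =>
      ⟨lt_of_lt_of_le hb₀.1 hx.1, lt_of_le_of_lt hx.2 hu⟩
    have h := intermediate_value_Icc' hb₀.2.le (hWD.continuousOn.mono hsub)
    rw [hW1, hWb₀] at h
    exact Set.image_mono hsub (h hw)
  have hbs : ∀ w ∈ W '' D, ContDiffAt ℝ ∞ b w := by
    rintro _ ⟨x, hx, rfl⟩
    exact (hinv x hx).1
  have has : ∀ w ∈ W '' D, ContDiffAt ℝ ∞ (A ∘ b) w := by
    intro w hw
    obtain ⟨x, hx, hxw⟩ := id hw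
    refine ContDiffAt.comp w (hAs.contDiffAt (Ioi_mem_nhds ?_)) (hbs w hw)
    rw [← hxw, hbW x hx]
    exact hx.1
  have hApos : ∀ x, 0 < A x := sineRatio_pos n r c
  have hb'neg : ∀ w ∈ W '' D, deriv b w < 0 := by
    rintro _ ⟨x, hx, rfl⟩
    rw [(hinv x hx).2]
    exact inv_lt_zero.2 (hW' x hx)
  have hsphere : ∀ w ∈ W '' D, w * A (b w) ^ 2 + b w ^ 2 = 1 := by
    rintro _ ⟨x, hx, rfl⟩
    rw [hbW x hx, hWdef, sineSq, div_mul_cancel₀ _ (pow_pos (hApos x) 2).ne', sub_add_cancel]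
  have hsphere' : ∀ w ∈ W '' D, A (b w) ^ 2 + 2 * w * A (b w) * deriv (A ∘ b) w +
      2 * b w * deriv b w = 0 := by
    intro w hw
    have h1 := ((has w hw).differentiableAt (by simp)).hasDerivAt
    have h2 := ((hbs w hw).differentiableAt (by simp)).hasDerivAt
    have h3 := ((hasDerivAt_id w).mul (h1.pow 2)).add (h2.pow 2)
    have h4 : HasDerivAt (fun _ : ℝ => (1 : ℝ)) _ w := h3.congr_of_eventuallyEq
      (Filter.eventuallyEq_of_mem (hU.mem_nhds hw) fun y hy => (hsphere y hy).symm)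
    have h5 := h4.unique (hasDerivAt_const w 1)
    simp only [id, Function.comp_apply, Pi.pow_apply] at h5
    push_cast at h5
    linear_combination h5
  obtain ⟨T, hTs, hT', hTneg⟩ := exists_odd_primitive
    (k := fun x => 2 * deriv b (1 - x ^ 2) / A (b (1 - x ^ 2)))
    (V := (fun x : ℝ => 1 - x ^ 2) ⁻¹' (W '' D)) (hU.preimage (by fun_prop))
    (fun x hx => hIU _ (one_sub_sq_mem_Icc hx)) (by
      have hbU : ContDiffOn ℝ ∞ (deriv b) (W '' D) :=
        ((contDiffOn_infty_iff_deriv_of_isOpen hU).1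
          fun w hw => (hbs w hw).contDiffWithinAt).2
      have haU : ContDiffOn ℝ ∞ (A ∘ b) (W '' D) := fun w hw => (has w hw).contDiffWithinAt
      have hsq : ContDiffOn ℝ ∞ (fun x : ℝ => 1 - x ^ 2)
        ((fun x : ℝ => 1 - x ^ 2) ⁻¹' (W '' D)) := by fun_prop
      exact (contDiffOn_const.mul (hbU.comp hsq fun x hx => hx)).div
        (haU.comp hsq fun x hx => hx) fun x _ => (hApos _).ne')
    (fun x => by simp only [neg_sq])
  have hb1 : b 1 = b₀ := by rw [← hWb₀, hbW b₀ hb₀D]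
  refine ⟨A ∘ b, b, T, ⟨fun w hw => has w (hIU w hw), fun w hw => hbs w (hIU w hw), hTs,
    fun w _ => hApos _, fun w hw => hb'neg w (hIU w hw), fun w hw => hsphere w (hIU w hw),
    fun w hw => hsphere' w (hIU w hw), hT', fun x _ => hTneg x⟩, fun w hw => ?_, fun h1 => ?_,
    fun h1 => ?_⟩
  · obtain ⟨x, hx, rfl⟩ := hIU w hw
    have h := hl.curvature_eq hH hx.1 hc
    have h2 : -(A x) / (2 * (deriv W x)⁻¹) = -(A x) * deriv W x / 2 := by
      rw [← div_div, div_inv_eq_mul]; ring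
    rw [(hinv x hx).2, Function.comp_apply, hbW x hx, h2]
    exact h
  · rw [hb1]
    have h0 : l = 0 := by rw [hldef, cosLower, if_neg h1.ne']
    rw [← h0]
    exact hb₀.1
  · subst h1
    have h0 : l = -1 := by rw [hldef, cosLower, if_pos rfl]
    have h0D : (0 : ℝ) ∈ D := ⟨by rw [h0]; norm_num, by linarith⟩
    have hcH : c = H := by rw [hc]; simp
    have hW0 : W 0 = (H * sineIntegral n) ^ 2 := by rw [hWdef, sineSq_one_zero hn hc0, hcH]
    have hS : 0 < sineIntegral n := by
      rw [← densityAvg_one_zero hn]; exact hl.densityAvg_pos h0D.1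
    have hHS : 0 < H * sineIntegral n := mul_pos hH hS
    rw [hb1]
    constructor
    · rw [← hanti.lt_iff_gt hb₀D h0D, hWb₀, hW0, one_lt_sq_iff₀ hHS.le]
    · rw [← hanti.lt_iff_gt h0D hb₀D, hWb₀, hW0, sq_lt_one_iff₀ hHS.le]

end SphereTimesLine

end

theorem mainTheorem5 (n : ℕ) (hn : 2 ≤ n) (r : ℕ) (hr : 1 ≤ r) (hrn : r ≤ n) (H : ℝ) (hH : 0 < H) :
    ∃ (F : SphereTimesLine.Sph n → SphereTimesLine.Sph n × ℝ)
      (N : SphereTimesLine.Sph n → SphereTimesLine.Amb n),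
      SphereTimesLine.IsEmbeddedHypersurface F ∧
      SphereTimesLine.IsUnitNormal F N ∧
      (∀ p, SphereTimesLine.meanCurvature F N r p = H) ∧
      SphereTimesLine.IsRotational F ∧
      (∃ t₀ : ℝ, SphereTimesLine.IsSymmetricAbout F t₀) ∧
      ((1 < r ∨ (r = 1 ∧ 1 / SphereTimesLine.sineIntegral n < H)) →
        SphereTimesLine.IsStrictlyConvex F N) ∧
      (r = 1 ∧ H = 1 / SphereTimesLine.sineIntegral n →
        SphereTimesLine.IsConvex F N ∧ ¬ SphereTimesLine.IsStrictlyConvex F N) ∧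
      (r = 1 ∧ H < 1 / SphereTimesLine.sineIntegral n →
        ¬ SphereTimesLine.IsConvex F N) := by
  have hn1 : 1 ≤ n := by omega
  obtain ⟨a, b, T, h, hcurv, hb1, hbr⟩ := SphereTimesLine.exists_profile hn hr hrn hH
  obtain ⟨e, p, hp⟩ := SphereTimesLine.exists_axis_equator hn1
  have hS : 0 < SphereTimesLine.sineIntegral n := by
    have hl := SphereTimesLine.isAdmissible_cosLower hn le_rfl hn1
    rw [← SphereTimesLine.densityAvg_one_zero hn]
    exact hl.densityAvg_pos (by simp [SphereTimesLine.cosLower])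
  refine ⟨h.sphereMap e, SphereTimesLine.profileNormal a b e, h.isEmbeddedHypersurface e,
    h.isUnitNormal e, fun q => ?_, h.isRotational e, ⟨0, h.isSymmetricAbout e⟩, ?_, ?_, ?_⟩
  · rw [h.meanCurvature_eq e hn1 hr q rfl]
    exact hcurv _ (SphereTimesLine.one_sub_sq_mem_Icc (SphereTimesLine.inner_mem_Icc e q))
  · rintro (h1 | ⟨h1, h2⟩)
    · exact h.isStrictlyConvex e hn1 (hb1 h1)
    · exact h.isStrictlyConvex e hn1 ((hbr h1).1.2 ((div_lt_iff₀ hS).1 h2))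
  · rintro ⟨h1, h2⟩
    have h3 : H * SphereTimesLine.sineIntegral n = 1 := by rw [h2, one_div_mul_cancel hS.ne']
    have h4 : b 1 = 0 := by
      refine le_antisymm (not_lt.1 fun h5 => ?_) (not_lt.1 fun h5 => ?_)
      · exact absurd ((hbr h1).1.1 h5) (by rw [h3]; exact lt_irrefl 1)
      · exact absurd ((hbr h1).2.1 h5) (by rw [h3]; exact lt_irrefl 1)
    exact ⟨h.isConvex e hn1 h4.ge, h.not_isStrictlyConvex e hn h4 hp⟩
  · rintro ⟨h1, h2⟩
    exact h.not_isConvex e hn ((hbr h1).2.2 ((lt_div_iff₀ hS).1 h2)) hp
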